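/- Let $S$ be a cancellative, countable, abelian semigroup. Let $\beta S$ be the Stone--Čech compactification of the discrete space $S$, equipped with the unique product extending that of $S$ for which it is a compact right topological semigroup (so $x\mapsto xy$ is continuous for each $y\in\beta S$) and for which $x\mapsto sx$ is continuous for each $s\in S$; let $S^*=\beta S\setminus S$, regarded as a semigroup under this product, and let $K(S^*)$ be its minimum ideal, that is, the smallest non-empty two-sided ideal of $S^*$ (with $K(S^*)=\emptyset$ if $S$ is finite, in which case $S^*=\emptyset$). Let $\ell^1(S^*)$ be the complex algebra of all $f:S^*\to\mathbb C$ with $\sum_{x}|f(x)|<\infty$, with the convolution product $$(f\star g)(t)=\sum\{f(r)g(s): r,s\in S^*,\ rs=t\}\qquad(t\in S^*),$$ write $\delta_p$ for the characteristic function of $\{p\}$ and $\operatorname{supp} f=\{x\in S^*: f(x)\neq 0\}$, and let $J(S^*)$ be the Jacobson radical of $\ell^1(S^*)$, that is, the set of its elements which lie in every maximal left ideal of the algebra obtained from $\ell^1(S^*)$ by adjoining an identity. Let $f\in\ell^1(S^*)$. Then $f\in J(S^*)$ if and only if $\operatorname{supp} f\subset K(S^*)$ and $\delta_p\star f\star\delta_q=0$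 for all $p,q\in K(S^*)$. Further, in this case, $g\star f$ is nilpotent of index at most $3$ (that is, $(g\star f)^{\star n}=0$ for some $n\in\{1,2,3\}$) for each $g\in\ell^1(S^*)$. -/

import Mathlib

universe u

/-! ### The Banach algebra `ℓ¹(T)` of a semigroup `T` -/

/-- The space `ℓ¹(T)` of summable complex functions on a set `T`; when `T` is a semigroup it is
given the convolution product below. -/
def EllOne (T : Type u) : Type u := lp (fun _ : T => ℂ) 1

namespace EllOne

section space

variable {T : Type u}

noncomputable instance : NormedAddCommGroup (EllOne T) :=
  inferInstanceAs (NormedAddCommGroup (lp (fun _ : T => ℂ) 1))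

noncomputable instance : NormedSpace ℂ (EllOne T) :=
  inferInstanceAs (NormedSpace ℂ (lp (fun _ : T => ℂ) 1))

instance : FunLike (EllOne T) T ℂ where
  coe f := f.1
  coe_injective := fun _ _ h => Subtype.ext h

theorem ext' {f g : EllOne T} (h : ∀ t, f t = g t) : f = g :=
  DFunLike.ext f g h

theorem add_apply (f g : EllOne T) (t : T) : (f + g) t = f t + g t := rfl

theorem smul_apply (c : ℂ) (f : EllOne T) (t : T) : (c • f) t = c * f t := rfl

theorem zero_apply (t : T) : (0 : EllOne T) t = 0 := rfl

theorem summable (f : EllOne T) : Summable (fun t => f t) := by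
  have h : Memℓp (fun t => f t) 1 := f.2
  have h1 := h.summable (by norm_num)
  simp only [ENNReal.toReal_one, Real.rpow_one] at h1
  exact h1.of_norm

/-- The element of `ℓ¹(T)` given by a summable function. -/
def ofSummable (f : T → ℂ) (hf : Summable f) : EllOne T :=
  ⟨f, memℓp_gen (by simpa using hf.norm)⟩

/-- The characteristic function `δ_t` of `{t}`. -/
noncomputable def delta (t : T) : EllOne T :=
  ofSummable (Set.indicator {t} (fun _ => 1)) (summable_of_hasFiniteSupport
    ((Set.finite_singleton t).subset (Set.support_indicator_subset)))

/-- The support of `f`. -/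
def supp (f : EllOne T) : Set T := {t | f t ≠ 0}

end space

section convolution

variable {T : Type u}

theorem summable_prod (f g : EllOne T) :
    Summable (fun x : T × T => f x.1 * g x.2) :=
  summable_mul_of_summable_norm f.summable.norm g.summable.norm

theorem summable_pair (f g : EllOne T) (φ : T × T → ℂ) (hφ : ∀ x, ‖φ x‖ ≤ 1) :
    Summable (fun x : T × T => f x.1 * g x.2 * φ x) := by
  refine Summable.of_norm_bounded (summable_prod f g).norm (fun x => ?_)
  rw [norm_mul]
  exact mul_le_of_le_one_right (norm_nonneg _) (hφ x)

variable [Mul T]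

/-- The value at `t` of the convolution: `∑ {f(r) g(s) : r s = t}`. -/
noncomputable def convFun (f g : T → ℂ) (t : T) : ℂ :=
  ∑' x : {x : T × T // x.1 * x.2 = t}, f x.1.1 * g x.1.2

theorem summable_convFun (f g : EllOne T) : Summable (convFun (fun t => f t) (fun t => g t)) := by
  have h := (Equiv.sigmaFiberEquiv (fun x : T × T => x.1 * x.2)).summable_iff.2 (summable_prod f g)
  exact h.sigma

/-- Convolution product on `ℓ¹(T)`. -/
noncomputable instance : Mul (EllOne T) :=
  ⟨fun f g => ofSummable (convFun (fun t => f t) (fun t => g t)) (summable_convFun f g)⟩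

theorem mul_apply (f g : EllOne T) (t : T) :
    (f * g) t = ∑' x : {x : T × T // x.1 * x.2 = t}, f x.1.1 * g x.1.2 := rfl

theorem summable_fiber (f g : EllOne T) (t : T) :
    Summable (fun x : {x : T × T // x.1 * x.2 = t} => f x.1.1 * g x.1.2) :=
  (summable_prod f g).subtype {x : T × T | x.1 * x.2 = t}

theorem tsum_mul_apply (f g : EllOne T) (φ : T → ℂ) (hφ : ∀ t, ‖φ t‖ ≤ 1) :
    ∑' t, (f * g) t * φ t = ∑' x : T × T, f x.1 * g x.2 * φ (x.1 * x.2) := by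
  have hs := summable_pair f g (fun x => φ (x.1 * x.2)) (fun x => hφ _)
  have h := (Equiv.sigmaFiberEquiv (fun x : T × T => x.1 * x.2)).summable_iff.2 hs
  rw [← (Equiv.sigmaFiberEquiv (fun x : T × T => x.1 * x.2)).tsum_eq]
  refine Eq.trans ?_ (Summable.tsum_sigma h).symm
  refine tsum_congr (fun t => ?_)
  rw [mul_apply, ← tsum_mul_right]
  refine tsum_congr (fun x => ?_)
  obtain ⟨x, rfl⟩ := x
  rfl

theorem mul_apply_eq (f g : EllOne T) (t : T) : (f * g) t =
    ∑' x : T × T, f x.1 * g x.2 * Set.indicator {t} (fun _ => (1 : ℂ)) (x.1 * x.2) := by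
  have := tsum_mul_apply f g (Set.indicator {t} (fun _ => (1 : ℂ))) (fun s => by
    by_cases hs : s = t <;> simp [hs])
  rw [← this, tsum_eq_single t]
  · simp
  · intro s hs
    simp [hs]

end convolution

section algebra

variable {T : Type u} [Semigroup T]

protected theorem mul_assoc' (f g h : EllOne T) : f * g * h = f * (g * h) := by
  apply ext'
  intro t
  obtain ⟨e, he, b⟩ : ∃ e : T → ℂ, Set.indicator {t} (fun _ => (1 : ℂ)) = e ∧ ∀ s, ‖e s‖ ≤ 1 :=
    ⟨_, rfl, fun s => by by_cases hs : s = t <;> simp [hs]⟩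
  have e1 : (f * g * h) t = ∑' x : (T × T) × T, f x.1.1 * g x.1.2 * h x.2 *
      e (x.1.1 * x.1.2 * x.2) := by
    have hs : Summable (fun x : (T × T) × T => f x.1.1 * g x.1.2 * h x.2 *
        e (x.1.1 * x.1.2 * x.2)) := by
      have h0 := (summable_mul_of_summable_norm (summable_prod f g).norm h.summable.norm).norm
      refine Summable.of_norm_bounded h0 (fun x => ?_)
      rw [norm_mul]
      exact mul_le_of_le_one_right (norm_nonneg _) (b _)
    rw [mul_apply_eq, he, ← (Equiv.prodComm T T).tsum_eq, ← (Equiv.prodComm T (T × T)).tsum_eq]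
    refine (Summable.tsum_prod ((Equiv.prodComm T T).summable_iff.2
      (summable_pair (f * g) h (fun x => e (x.1 * x.2))
        (fun x => b _)))).trans ?_
    refine Eq.trans ?_ (Summable.tsum_prod
      ((Equiv.prodComm T (T × T)).summable_iff.2 hs)).symm
    refine tsum_congr (fun z => ?_)
    have := tsum_mul_apply f g (fun w => e (w * z)) (fun w => b _)
    calc _ = ∑' w, h z * ((f * g) w * e (w * z)) :=
          tsum_congr (fun w => by
            simp only [Function.comp_apply, Equiv.prodComm_apply, Prod.swap_prod_mk]
            ring)
      _ = ∑' x : T × T, h z * (f x.1 * g x.2 * e (x.1 * x.2 * z)) := by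
          rw [tsum_mul_left, this, tsum_mul_left]
      _ = _ := tsum_congr (fun x => by
            simp only [Function.comp_apply, Equiv.prodComm_apply, Prod.swap_prod_mk]
            ring)
  have e2 : (f * (g * h)) t = ∑' x : T × (T × T), f x.1 * (g x.2.1 * h x.2.2) *
      e (x.1 * (x.2.1 * x.2.2)) := by
    have hs : Summable (fun x : T × (T × T) => f x.1 * (g x.2.1 * h x.2.2) *
        e (x.1 * (x.2.1 * x.2.2))) := by
      have h0 := (summable_mul_of_summable_norm f.summable.norm (summable_prod g h).norm).norm
      refine Summable.of_norm_bounded h0 (fun x => ?_)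
      rw [norm_mul]
      exact mul_le_of_le_one_right (norm_nonneg _) (b _)
    rw [mul_apply_eq, he, (summable_pair f (g * h) (fun x => e (x.1 * x.2))
      (fun x => b _)).tsum_prod, hs.tsum_prod]
    refine tsum_congr (fun z => ?_)
    have := tsum_mul_apply g h (fun w => e (z * w)) (fun w => b _)
    calc _ = ∑' w, f z * ((g * h) w * e (z * w)) :=
          tsum_congr (fun w => by ring)
      _ = ∑' x : T × T, f z * (g x.1 * h x.2 * e (z * (x.1 * x.2))) := by
          rw [tsum_mul_left, this, tsum_mul_left]
      _ = _ := tsum_congr (fun x => by ring)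
  rw [e1, e2, ← (Equiv.prodAssoc T T T).tsum_eq]
  refine tsum_congr (fun x => ?_)
  obtain ⟨⟨x, y⟩, z⟩ := x
  simp only [Equiv.prodAssoc_apply, mul_assoc]

noncomputable instance : NonUnitalRing (EllOne T) :=
  { (inferInstance : AddCommGroup (EllOne T)), (inferInstance : Mul (EllOne T)) with
    mul_assoc := EllOne.mul_assoc'
    left_distrib := fun f g h => ext' (fun t => by
      simp only [add_apply, mul_apply, mul_add]
      exact (summable_fiber f g t).tsum_add (summable_fiber f h t))
    right_distrib := fun f g h => ext' (fun t => by
      simp only [add_apply, mul_apply, add_mul]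
      exact (summable_fiber f h t).tsum_add (summable_fiber g h t))
    zero_mul := fun f => ext' (fun t => by simp [mul_apply, zero_apply])
    mul_zero := fun f => ext' (fun t => by simp [mul_apply, zero_apply]) }

instance : IsScalarTower ℂ (EllOne T) (EllOne T) :=
  ⟨fun c f g => ext' (fun t => by
    simp only [smul_eq_mul, smul_apply, mul_apply, mul_assoc, tsum_mul_left])⟩

instance : SMulCommClass ℂ (EllOne T) (EllOne T) :=
  ⟨fun c f g => ext' (fun t => by
    simp only [smul_eq_mul, smul_apply, mul_apply, mul_left_comm _ c, tsum_mul_left])⟩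

end algebra

end EllOne

/-! ### Radical and nilpotent elements of a complex algebra -/

section radical

variable (A : Type u) [NonUnitalRing A] [Module ℂ A] [IsScalarTower ℂ A A] [SMulCommClass ℂ A A]

/-- The Jacobson radical of a complex algebra `A`: the elements of `A` lying in every maximal left
ideal of the algebra obtained by adjoining an identity to `A`. (If `A` already has an identity,
the unitization is `A × ℂ` as an algebra, and one gets the intersection of the maximal left
ideals of `A` itself.) -/
def jacobsonRadical : Set A :=
  {a | ∀ I : Ideal (Unitization ℂ A), I.IsMaximal → (a : Unitization ℂ A) ∈ I}

variable {A}

/-- `a` is nilpotent of index at most `k`: `a ^ n = 0` for some `1 ≤ n ≤ k`. (The power is taken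
in the unitization, which contains `A` as a subalgebra.) -/
def IsNilpotentOfIndexAtMost (a : A) (k : ℕ) : Prop :=
  ∃ n : ℕ, 1 ≤ n ∧ n ≤ k ∧ (a : Unitization ℂ A) ^ n = 0

end radical

/-! ### Minimum ideal -/

/-- A non-empty two-sided ideal of a semigroup. -/
structure IsSemigroupIdeal {T : Type u} [Mul T] (I : Set T) : Prop where
  nonempty : I.Nonempty
  mul_mem_left : ∀ s, ∀ t ∈ I, s * t ∈ I
  mul_mem_right : ∀ s, ∀ t ∈ I, t * s ∈ I

/-- The minimum ideal `K(T)` of a semigroup `T`, as the intersection of all (non-empty) ideals;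
whenever `T` has a smallest ideal, in particular for every non-empty compact right topological
semigroup, this is that ideal. -/
def minimumIdeal (T : Type u) [Mul T] : Set T := ⋂₀ {I | IsSemigroupIdeal I}

/-! ### The semigroup `S* = βS \ S` -/

/-- The remainder `S* = βS \ S` of the Stone-Čech compactification `βS` of the discrete space `S`;
the points of `βS` are the ultrafilters on `S`, and `s ∈ S` is the principal ultrafilter at `s`. -/
def StoneCechRemainder (S : Type u) : Type u := {p : Ultrafilter S // ∀ s : S, p ≠ pure s}

attribute [local instance] Ultrafilter.semigroup in
/-- `S*` is closed under the product of `βS` if `S` is cancellative. -/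
theorem StoneCechRemainder.mul_ne_pure {S : Type u} [Semigroup S] [IsCancelMul S]
    (p q : Ultrafilter S) (hq : ∀ s : S, q ≠ pure s) (s : S) : p * q ≠ pure s := by
  intro h
  have h1 : ∀ᶠ m in (p * q : Ultrafilter S), m = s := by
    rw [h]
    simp
  rw [Ultrafilter.eventually_mul] at h1
  obtain ⟨m, hm⟩ := h1.exists
  obtain ⟨n, hn⟩ := hm.exists
  refine hq n (Ultrafilter.coe_le_coe.1 ?_)
  simp only [Ultrafilter.coe_pure, Filter.le_pure_iff]
  filter_upwards [hm] with k hk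
  exact mul_left_cancel (hk.trans hn.symm)

attribute [local instance] Ultrafilter.semigroup in
/-- The semigroup `(S*, □)`, with the product of `βS` that makes it a compact right topological
semigroup: `A ∈ p □ q` if and only if `{s : {t : s t ∈ A} ∈ q} ∈ p`, so that `p ↦ p □ q` is
continuous for every `q`. -/
instance StoneCechRemainder.instSemigroup {S : Type u} [Semigroup S] [IsCancelMul S] :
    Semigroup (StoneCechRemainder S) where
  mul p q := ⟨p.1 * q.1, StoneCechRemainder.mul_ne_pure p.1 q.1 q.2⟩
  mul_assoc p q r := Subtype.ext (mul_assoc p.1 q.1 r.1)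

/-!
Write `T = S*` and `K` for its minimum ideal.

If `f` lives on `K` and `δ_p * f * δ_q = 0` for `p, q ∈ K`, then `a * f * b = 0` whenever `a` and
`b` are supported on `K`, because `ℓ¹` is spanned by point masses. As `K` is an ideal, this kills
`(y * f) ^ 3 = (y * f * y) * f * (y * f)` for all `y` in the unitization, so `f` generates a nil
left ideal (`EllOne.pow_three_eq_zero`).

Both parts of the converse rest on the same obstruction. An element `a` of the radical is
quasi-nilpotent, so that the norms of its powers do not grow geometrically
(`exists_norm_succPow_lt_of_mem_jacobsonRadical`). But for a group `G` and `h ∈ ℓ¹(G)` with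
`h ≠ 0`, the values at `1` of the powers of `h^* * h` do (`EllOne.pow_le_norm_succPow_one`). Hence
it is enough to find such an `h^* * h` inside an element of the radical.

* For `p, q ∈ K`, an idempotent `e` generating a minimal left ideal gives a group `e * T * e` with
  `K = T * e * T`, and `δ_p * f * δ_q` is built from an element of the radical supported on this
  group (`EllOne.delta_mul_mul_delta_eq_zero`).
* To see that `f` vanishes at `p ∉ K`, embed `S` into its group of fractions `G`, which is
  countable, and `T` into `βG`. The translates of `p` by `G` are pairwise distinct, and
  `h(g) = f(g * p)` is an element of `ℓ¹(G)`. A suitable `q ∈ βG` makes a copy of `h^* * h` appear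
  in `u * f`, where `u = ∑ h^*(g) δ_{g * q}`: it suffices that `q * p` is right cancellable and
  that `βG * q * r` is disjoint from `βG * q * p` for all `r ∈ supp f` outside the orbit of `p`
  (`EllOne.apply_eq_zero_of_mem_jacobsonRadical`).

The ultrafilter `q` is found in `Ultrafilter.exists_mul_right_cancellable`. A point `x` of `K`
whose translates by `G` all lie in `T` satisfies `p ∉ βG * x * r` for all `r ∈ T`. Since only
countably many `r` matter, a sparse sequence chosen along `x` has the same property for all of its
free limits `q` in place of `x`. If the closures of two countable subsets of `βG` meet, then one
of the sets meets the closure of the other (`Ultrafilter.exists_of_map_mul_eq`); this turns the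
coincidences between left ideals that have to be excluded either into coincidences between terms
of the sequence, impossible by sparseness, or into memberships `p ∈ βG * q * r` or
`r ∈ βG * q * p`. The latter happens for at most one limit `q` for each `r`, so it can be avoided
by thinning out the sequence.
-/

open Filter
open scoped Topology

namespace EllOne

/-! ### The Banach algebra structure of `ℓ¹(T)` -/

section banach

variable {T : Type u}

theorem norm_eq_tsum (f : EllOne T) : ‖f‖ = ∑' t, ‖f t‖ := by
  have h := lp.norm_eq_tsum_rpow (p := 1) (by norm_num) (show lp (fun _ : T => ℂ) 1 from f)
  simp only [ENNReal.toReal_one, Real.rpow_one, div_one] at h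
  exact h

theorem norm_apply_le (f : EllOne T) (t : T) : ‖f t‖ ≤ ‖f‖ := by
  rw [norm_eq_tsum]
  exact f.summable.norm.le_tsum t fun _ _ => norm_nonneg _

theorem summable_norm_sq (f : EllOne T) : Summable fun g => ‖f g‖ ^ 2 := by
  refine Summable.of_nonneg_of_le (fun _ => by positivity) (fun g => ?_)
    (f.summable.norm.mul_left ‖f‖)
  rw [sq]
  exact mul_le_mul_of_nonneg_right (norm_apply_le f g) (norm_nonneg _)

instance : CompleteSpace (EllOne T) :=
  inferInstanceAs (CompleteSpace (lp (fun _ : T => ℂ) 1))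

theorem delta_apply_self (t : T) : delta t t = 1 :=
  Set.indicator_of_mem (Set.mem_singleton t) (fun _ => (1 : ℂ))

theorem delta_apply_of_ne {s t : T} (h : s ≠ t) : delta t s = 0 :=
  Set.indicator_of_notMem (s := {t}) h (fun _ => (1 : ℂ))

/-- Every element of `ℓ¹(T)` is the norm-convergent sum of its point masses. -/
theorem hasSum_smul_delta (f : EllOne T) : HasSum (fun t => f t • delta t) f := by
  classical
  have h := lp.hasSum_single (p := 1) (by norm_num) (show lp (fun _ : T => ℂ) 1 from f)
  have e : (fun t => f t • delta t) = fun t => (lp.single 1 t (f t) : lp (fun _ : T => ℂ) 1) := by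
    funext t
    refine ext' fun s => ?_
    change f t * delta t s = (Pi.single t (f t) : T → ℂ) s
    by_cases hs : s = t
    · subst hs
      rw [delta_apply_self, Pi.single_eq_same, mul_one]
    · rw [delta_apply_of_ne hs, Pi.single_eq_of_ne hs, mul_zero]
  rw [e]
  exact h

theorem norm_mul_le' [Mul T] (f g : EllOne T) : ‖f * g‖ ≤ ‖f‖ * ‖g‖ := by
  have hs : Summable fun x : T × T => ‖f x.1‖ * ‖g x.2‖ :=
    f.summable.norm.mul_of_nonneg g.summable.norm (fun _ => norm_nonneg _) fun _ => norm_nonneg _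
  have hσ := (Equiv.sigmaFiberEquiv (fun x : T × T => x.1 * x.2)).summable_iff.2 hs
  have hle : ∀ t, ‖(f * g) t‖ ≤
      ∑' x : {x : T × T // x.1 * x.2 = t}, ‖f x.1.1‖ * ‖g x.1.2‖ := fun t => by
    rw [mul_apply]
    refine (norm_tsum_le_tsum_norm (summable_fiber f g t).norm).trans_eq ?_
    simp only [norm_mul]
  calc ‖f * g‖ = ∑' t, ‖(f * g) t‖ := norm_eq_tsum _
    _ ≤ ∑' t, ∑' x : {x : T × T // x.1 * x.2 = t}, ‖f x.1.1‖ * ‖g x.1.2‖ :=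
        (f * g).summable.norm.tsum_le_tsum hle hσ.sigma
    _ = ∑' x : T × T, ‖f x.1‖ * ‖g x.2‖ := by
        rw [← (Equiv.sigmaFiberEquiv (fun x : T × T => x.1 * x.2)).tsum_eq]
        exact (Summable.tsum_sigma hσ).symm
    _ = ‖f‖ * ‖g‖ := by
        rw [norm_eq_tsum, norm_eq_tsum]
        exact (f.summable.norm.tsum_mul_tsum g.summable.norm hs).symm

/-- `ℓ¹(T)` as a normed ring. This is a definition, made an instance only inside proofs, so that the
ring structure of `ℓ¹(T)` is found along a single path. -/
@[reducible]
noncomputable def nonUnitalNormedRing [Semigroup T] : NonUnitalNormedRing (EllOne T) :=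
  { (inferInstance : NormedAddCommGroup (EllOne T)),
    (inferInstance : NonUnitalRing (EllOne T)) with
    norm_mul_le := norm_mul_le' }

end banach

/-! ### Functoriality of `ℓ¹` along injections -/

section functoriality

variable {T V : Type u}

/-- The push-forward of `f ∈ ℓ¹(T)` along an injection `j : T → V`, extended by zero. -/
noncomputable def map (j : T → V) (hj : j.Injective) (f : EllOne T) : EllOne V :=
  ofSummable (Function.extend j (fun t => f t) 0) ((summable_extend_zero hj).2 f.summable)

theorem map_apply {j : T → V} (hj : j.Injective) (f : EllOne T) (t : T) :
    map j hj f (j t) = f t :=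
  hj.extend_apply _ _ _

theorem map_apply_of_notMem {j : T → V} (hj : j.Injective) (f : EllOne T) {v : V}
    (hv : v ∉ Set.range j) : map j hj f v = 0 :=
  Function.extend_apply' _ _ _ fun ⟨t, ht⟩ => hv ⟨t, ht⟩

theorem exists_of_map_apply_ne_zero {j : T → V} (hj : j.Injective) (f : EllOne T) {v : V}
    (hv : map j hj f v ≠ 0) : ∃ t, j t = v ∧ f t ≠ 0 := by
  by_cases h : v ∈ Set.range j
  · obtain ⟨t, rfl⟩ := h
    exact ⟨t, rfl, by rwa [map_apply] at hv⟩
  · exact absurd (map_apply_of_notMem hj f h) hv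

/-- The pull-back `a ∘ α ∈ ℓ¹(T)` of `a ∈ ℓ¹(V)` along an injection `α : T → V`. -/
def comap (α : T → V) (hα : α.Injective) (a : EllOne V) : EllOne T :=
  ofSummable (fun t => a (α t)) (a.summable.comp_injective hα)

theorem comap_apply {α : T → V} (hα : α.Injective) (a : EllOne V) (t : T) :
    comap α hα a t = a (α t) := rfl

theorem comap_map {j : T → V} (hj : j.Injective) (f : EllOne T) : comap j hj (map j hj f) = f :=
  ext' fun t => map_apply hj f t

/-- If the factorizations of the elements of `range γ` within `supp a × supp b` all come from
products `α x * β y = γ (x * y)`, then pulling back turns the convolution product of `a` and `b`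
into the convolution product of their pull-backs. -/
theorem comap_mul [Mul T] [Mul V] {α β γ : T → V} (hα : α.Injective) (hβ : β.Injective)
    (hγ : γ.Injective) (hmul : ∀ x y, α x * β y = γ (x * y)) (a b : EllOne V)
    (hab : ∀ x y t, a x ≠ 0 → b y ≠ 0 → x * y = γ t → x ∈ Set.range α ∧ y ∈ Set.range β) :
    comap γ hγ (a * b) = comap α hα a * comap β hβ b := by
  refine ext' fun t => ?_
  rw [comap_apply, mul_apply, mul_apply]
  let i : {x : T × T // x.1 * x.2 = t} → {x : V × V // x.1 * x.2 = γ t} :=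
    fun x => ⟨(α x.1.1, β x.1.2), by rw [hmul, x.2]⟩
  have hi : i.Injective := by
    rintro ⟨⟨x, y⟩, hx⟩ ⟨⟨x', y'⟩, hx'⟩ h
    simp only [i, Subtype.mk.injEq, Prod.mk.injEq] at h
    simp only [Subtype.mk.injEq, Prod.mk.injEq]
    exact ⟨hα h.1, hβ h.2⟩
  refine (hi.tsum_eq (f := fun x : {x : V × V // x.1 * x.2 = γ t} => a x.1.1 * b x.1.2) ?_).symm
  rintro ⟨⟨x, y⟩, hxy⟩ hne
  obtain ⟨⟨x, rfl⟩, ⟨y, rfl⟩⟩ := hab x y t (left_ne_zero_of_mul hne) (right_ne_zero_of_mul hne) hxy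
  refine ⟨⟨(x, y), hγ ?_⟩, rfl⟩
  rw [← hmul]
  exact hxy

theorem exists_of_mul_apply_ne_zero [Mul T] {f g : EllOne T} {t : T} (h : (f * g) t ≠ 0) :
    ∃ x y, f x ≠ 0 ∧ g y ≠ 0 ∧ x * y = t := by
  by_contra! hc
  refine h ?_
  rw [mul_apply]
  refine (tsum_congr fun x => ?_).trans tsum_zero
  by_contra hne
  exact hc x.1.1 x.1.2 (left_ne_zero_of_mul hne) (right_ne_zero_of_mul hne) x.2

theorem map_mul_of_hom [Mul T] [Mul V] {j : T → V} (hj : j.Injective)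
    (hmul : ∀ x y, j (x * y) = j x * j y) (f g : EllOne T) :
    map j hj (f * g) = map j hj f * map j hj g := by
  refine ext' fun v => ?_
  by_cases hv : v ∈ Set.range j
  · obtain ⟨t, rfl⟩ := hv
    have h := comap_mul hj hj hj (fun x y => (hmul x y).symm) (map j hj f) (map j hj g)
      fun x y t hx hy _ => by
        obtain ⟨x', rfl, -⟩ := exists_of_map_apply_ne_zero hj f hx
        obtain ⟨y', rfl, -⟩ := exists_of_map_apply_ne_zero hj g hy
        exact ⟨⟨x', rfl⟩, ⟨y', rfl⟩⟩
    rw [comap_map, comap_map] at h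
    rw [map_apply, ← h, comap_apply]
  · rw [map_apply_of_notMem hj _ hv]
    by_contra hne
    obtain ⟨x, y, hx, hy, rfl⟩ := exists_of_mul_apply_ne_zero (Ne.symm hne)
    obtain ⟨x', rfl, -⟩ := exists_of_map_apply_ne_zero hj f hx
    obtain ⟨y', rfl, -⟩ := exists_of_map_apply_ne_zero hj g hy
    exact hv ⟨x' * y', hmul x' y'⟩

theorem norm_map_apply_le {j : T → V} (hj : j.Injective) (f : EllOne T) (v : V) :
    ‖map j hj f v‖ ≤ ‖f‖ := by
  by_cases hv : v ∈ Set.range j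
  · obtain ⟨t, rfl⟩ := hv
    rw [map_apply]
    exact norm_apply_le f t
  · rw [map_apply_of_notMem hj _ hv, norm_zero]
    exact norm_nonneg f

theorem delta_mul_delta [Mul T] (s t : T) : delta s * delta t = delta (s * t) := by
  refine ext' fun v => ?_
  rw [mul_apply_eq, tsum_eq_single (s, t)]
  · simp only [delta_apply_self, one_mul]
    by_cases hv : s * t = v
    · subst hv
      rw [delta_apply_self, Set.indicator_of_mem (Set.mem_singleton _)]
    · rw [delta_apply_of_ne (Ne.symm hv), Set.indicator_of_notMem (by simpa using hv)]
  · rintro ⟨x, y⟩ hne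
    by_cases hx : x = s
    · have hy : y ≠ t := fun hy => hne (by rw [hx, hy])
      rw [delta_apply_of_ne hy, mul_zero, zero_mul]
    · rw [delta_apply_of_ne hx, zero_mul, zero_mul]

theorem supp_mul_subset_of_left [Mul T] {K : Set T} (hK : ∀ s, ∀ t ∈ K, s * t ∈ K)
    (f : EllOne T) {g : EllOne T} (hg : supp g ⊆ K) : supp (f * g) ⊆ K := by
  intro t ht
  obtain ⟨x, y, -, hy, rfl⟩ := exists_of_mul_apply_ne_zero ht
  exact hK _ _ (hg hy)

theorem supp_mul_subset_of_right [Mul T] {K : Set T} (hK : ∀ s, ∀ t ∈ K, t * s ∈ K)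
    {f : EllOne T} (g : EllOne T) (hf : supp f ⊆ K) : supp (f * g) ⊆ K := by
  intro t ht
  obtain ⟨x, y, hx, -, rfl⟩ := exists_of_mul_apply_ne_zero ht
  exact hK _ _ (hf hx)

/-- The relation `δ_p * f * δ_q = 0` for `p, q ∈ K` extends bilinearly to elements supported
on `K`. -/
theorem mul_mul_eq_zero_of_supp_subset [Semigroup T] {K : Set T} {f : EllOne T}
    (hf : ∀ p ∈ K, ∀ q ∈ K, delta p * f * delta q = 0) {a b : EllOne T}
    (ha : supp a ⊆ K) (hb : supp b ⊆ K) : a * f * b = 0 := by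
  let _ : NonUnitalNormedRing (EllOne T) := nonUnitalNormedRing
  have key : ∀ p ∈ K, delta p * f * b = 0 := fun p hp => by
    have h := (hasSum_smul_delta b).mul_left (delta p * f)
    refine h.unique ?_
    convert! hasSum_zero with q
    by_cases hq : b q = 0
    · rw [hq, zero_smul, mul_zero]
    · rw [mul_smul_comm, hf p hp q (hb hq), smul_zero]
  have h := (hasSum_smul_delta a).mul_right (f * b)
  rw [mul_assoc]
  refine h.unique ?_
  convert! hasSum_zero with p
  by_cases hp : a p = 0
  · rw [hp, zero_smul, zero_mul]
  · rw [smul_mul_assoc, ← mul_assoc, key p (ha hp), smul_zero]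

end functoriality

end EllOne

/-! ### Elements of the Jacobson radical are quasi-nilpotent -/

section radical

variable {A : Type u} [NonUnitalRing A] [Module ℂ A] [IsScalarTower ℂ A A] [SMulCommClass ℂ A A]

theorem mem_jacobsonRadical_iff {a : A} :
    a ∈ jacobsonRadical A ↔
      (a : Unitization ℂ A) ∈ Ideal.jacobson (⊥ : Ideal (Unitization ℂ A)) := by
  simp only [Ideal.jacobson, Ideal.mem_sInf, jacobsonRadical, Set.mem_ofPred_eq, bot_le, true_and]

theorem jacobsonRadical_mul_left (b : A) {a : A} (ha : a ∈ jacobsonRadical A) :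
    b * a ∈ jacobsonRadical A := by
  rw [mem_jacobsonRadical_iff] at ha ⊢
  rw [Unitization.inr_mul]
  exact Ideal.mul_mem_left _ _ ha

theorem jacobsonRadical_mul_right {a : A} (ha : a ∈ jacobsonRadical A) (b : A) :
    a * b ∈ jacobsonRadical A := by
  rw [mem_jacobsonRadical_iff] at ha ⊢
  rw [Unitization.inr_mul]
  exact Ideal.mul_mem_right _ _ ha

theorem isUnit_add_one_of_mem_jacobson_bot {R : Type*} [Ring R] {x : R}
    (hx : x ∈ Ideal.jacobson (⊥ : Ideal R)) : IsUnit (x + 1) := by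
  have key : ∀ y ∈ Ideal.jacobson (⊥ : Ideal R), ∃ s, s * (y + 1) = 1 := fun y hy => by
    obtain ⟨s, hs⟩ := Ideal.exists_mul_add_sub_mem_of_mem_jacobson y hy
    exact ⟨s, sub_eq_zero.1 (by simpa using hs)⟩
  obtain ⟨s, hs⟩ := key x hx
  -- `s = 1 - s * x` is again of the form `y + 1` with `y` in the radical, so it has a left inverse
  obtain ⟨t, ht⟩ := key (-s * x) (Ideal.mul_mem_left _ _ hx)
  have hts : t * s = 1 := by
    have : -s * x + 1 = s := by
      rw [← hs]
      noncomm_ring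
    rwa [this] at ht
  have htx : t = x + 1 := by
    calc t = t * (s * (x + 1)) := by rw [hs, mul_one]
      _ = x + 1 := by rw [← mul_assoc, hts, one_mul]
  exact ⟨⟨x + 1, s, by rw [← htx, hts], hs⟩, rfl⟩

theorem isUnit_algebraMap_sub_of_mem_jacobson_bot {R : Type*} [Ring R] [Algebra ℂ R] {x : R}
    (hx : x ∈ Ideal.jacobson (⊥ : Ideal R)) {z : ℂ} (hz : z ≠ 0) :
    IsUnit (algebraMap ℂ R z - x) := by
  have h : algebraMap ℂ R z - x = algebraMap ℂ R z * (algebraMap ℂ R (-z⁻¹) * x + 1) := by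
    rw [mul_add, mul_one, ← mul_assoc, ← map_mul, mul_neg, mul_inv_cancel₀ hz, map_neg, map_one,
      neg_one_mul, add_comm, sub_eq_add_neg]
  rw [h]
  exact ((Ne.isUnit hz).map _).mul
    (isUnit_add_one_of_mem_jacobson_bot (Ideal.mul_mem_left _ _ hx))

/-- The power `a ^ (n + 1)` of an element of a ring without identity. -/
def succPow {R : Type*} [Mul R] (a : R) : ℕ → R
  | 0 => a
  | n + 1 => succPow a n * a

theorem inr_succPow (a : A) (n : ℕ) :
    ((succPow a n : A) : Unitization ℂ A) = (a : Unitization ℂ A) ^ (n + 1) := by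
  induction n with
  | zero => simp [succPow]
  | succ n ih => rw [succPow, Unitization.inr_mul, ih, pow_succ _ (n + 1)]

theorem succPow_two_mul_add_one (a : A) (n : ℕ) :
    succPow a (2 * n + 1) = succPow a n * succPow a n := by
  apply Unitization.inr_injective (R := ℂ)
  rw [Unitization.inr_mul, inr_succPow, inr_succPow, ← pow_add]
  congr 1
  omega

theorem succPow_mul_comm (a : A) (n : ℕ) : a * succPow a n = succPow a n * a := by
  apply Unitization.inr_injective (R := ℂ)
  rw [Unitization.inr_mul, Unitization.inr_mul, inr_succPow, ← pow_succ, ← pow_succ']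

end radical

/-- The spectral radius of an element of the radical is zero. -/
theorem spectralRadius_eq_zero_of_mem_jacobsonRadical {A : Type u} [NonUnitalNormedRing A]
    [NormedSpace ℂ A] [IsScalarTower ℂ A A] [SMulCommClass ℂ A A] {a : A}
    (ha : a ∈ jacobsonRadical A) : spectralRadius ℂ (WithLp.toLp 1 (a : Unitization ℂ A)) = 0 := by
  rw [mem_jacobsonRadical_iff] at ha
  rw [spectralRadius]
  refine le_antisymm (iSup₂_le fun z hz => ?_) bot_le
  by_cases hz0 : z = 0
  · simp [hz0]
  refine absurd ?_ hz
  set e := WithLp.unitizationAlgEquiv (𝕜 := ℂ) (A := A) ℂ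
  rw [spectrum.mem_resolventSet_iff, ← isUnit_map_iff e]
  exact isUnit_algebraMap_sub_of_mem_jacobson_bot ha hz0

/-- The powers of an element of the radical do not grow geometrically along the exponents
`2 ^ k`. -/
theorem exists_norm_succPow_lt_of_mem_jacobsonRadical {A : Type u} [NonUnitalNormedRing A]
    [NormedSpace ℂ A] [IsScalarTower ℂ A A] [SMulCommClass ℂ A A] [CompleteSpace A] {a : A}
    (ha : a ∈ jacobsonRadical A) {c : ℝ} (hc : 0 < c) :
    ∃ k : ℕ, ‖succPow a (2 ^ k - 1)‖ < c ^ 2 ^ k := by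
  have h := spectrum.pow_norm_pow_one_div_tendsto_nhds_spectralRadius
    (WithLp.toLp 1 (a : Unitization ℂ A))
  rw [spectralRadius_eq_zero_of_mem_jacobsonRadical ha] at h
  have h2 := h.comp (tendsto_pow_atTop_atTop_of_one_lt (one_lt_two : 1 < 2))
  obtain ⟨k, hk⟩ := (h2.eventually (gt_mem_nhds (ENNReal.ofReal_pos.2 hc))).exists
  refine ⟨k, ?_⟩
  have hpow : (WithLp.toLp 1 (a : Unitization ℂ A)) ^ 2 ^ k =
      WithLp.toLp 1 ((succPow a (2 ^ k - 1) : A) : Unitization ℂ A) := by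
    rw [inr_succPow, Nat.sub_add_cancel Nat.one_le_two_pow]
    exact (WithLp.unitizationAlgEquiv (𝕜 := ℂ) (A := A) ℂ).injective (map_pow _ _ _)
  simp only [Function.comp_apply, hpow, WithLp.unitization_norm_inr] at hk
  have hk' := (ENNReal.ofReal_lt_ofReal_iff hc).1 hk
  have hpos : (0 : ℝ) < ((2 ^ k : ℕ) : ℝ) := by positivity
  rw [one_div, Real.rpow_inv_lt_iff_of_pos (norm_nonneg _) hc.le hpos, Real.rpow_natCast] at hk'
  exact hk'

/-! ### The Hermitian square in the `ℓ¹`-algebra of a group -/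

namespace EllOne

section group

variable {G : Type u} [Group G]

/-- The involution `f^*(g) = conj (f (g⁻¹))` of `ℓ¹(G)`. -/
def conjInv (f : EllOne G) : EllOne G :=
  ofSummable (fun g => starRingEnd ℂ (f g⁻¹))
    (((Equiv.inv G).summable_iff.2 f.summable).map (starRingEnd ℂ) Complex.continuous_conj)

theorem conjInv_apply (f : EllOne G) (g : G) : conjInv f g = starRingEnd ℂ (f g⁻¹) := rfl

theorem conjInv_conjInv (f : EllOne G) : conjInv (conjInv f) = f :=
  ext' fun g => by simp [conjInv_apply]

theorem conjInv_mul (f h : EllOne G) : conjInv (f * h) = conjInv h * conjInv f := by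
  refine ext' fun g => ?_
  rw [conjInv_apply, mul_apply, mul_apply, Complex.conj_tsum]
  let e : {x : G × G // x.1 * x.2 = g} ≃ {x : G × G // x.1 * x.2 = g⁻¹} :=
    { toFun := fun x => ⟨(x.1.2⁻¹, x.1.1⁻¹), by rw [← mul_inv_rev, x.2]⟩
      invFun := fun x => ⟨(x.1.2⁻¹, x.1.1⁻¹), by rw [← mul_inv_rev, x.2, inv_inv]⟩
      left_inv := fun x => by simp
      right_inv := fun x => by simp }
  rw [← e.tsum_eq]
  refine tsum_congr fun x => ?_
  rw [map_mul, mul_comm]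
  rfl

/-- The value at `1` of `f^* * f` is the square of the `ℓ²`-norm of `f`. -/
theorem conjInv_mul_self_one (f : EllOne G) :
    (conjInv f * f) 1 = ((∑' g, ‖f g‖ ^ 2 : ℝ) : ℂ) := by
  rw [mul_apply]
  let e : G ≃ {x : G × G // x.1 * x.2 = 1} :=
    { toFun := fun g => ⟨(g⁻¹, g), inv_mul_cancel g⟩
      invFun := fun x => x.1.2
      left_inv := fun _ => rfl
      right_inv := fun x => Subtype.ext (Prod.ext (eq_inv_of_mul_eq_one_left x.2).symm rfl) }
  rw [← e.tsum_eq, Complex.ofReal_tsum]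
  refine tsum_congr fun g => ?_
  simp only [e, Equiv.coe_fn_mk, conjInv_apply, inv_inv]
  rw [mul_comm, Complex.mul_conj, Complex.normSq_eq_norm_sq]

theorem norm_sq_le_norm_conjInv_mul_self_one (f : EllOne G) (g : G) :
    ‖f g‖ ^ 2 ≤ ‖(conjInv f * f) 1‖ := by
  rw [conjInv_mul_self_one, Complex.norm_real]
  refine le_trans ?_ (le_abs_self _)
  exact (summable_norm_sq f).le_tsum g fun _ _ => by positivity

theorem conjInv_succPow {b : EllOne G} (hb : conjInv b = b) (n : ℕ) :
    conjInv (succPow b n) = succPow b n := by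
  induction n with
  | zero => exact hb
  | succ n ih => rw [succPow, conjInv_mul, ih, hb, succPow_mul_comm]

/-- For `b = f^* * f` the values at `1` of the powers `b ^ (2 ^ k)` grow geometrically, since
squaring a self-adjoint element at least squares the modulus of its value at `1`. -/
theorem pow_le_norm_succPow_one (f : EllOne G) (g : G) (k : ℕ) :
    (‖f g‖ ^ 2) ^ 2 ^ k ≤ ‖succPow (conjInv f * f) (2 ^ k - 1) 1‖ := by
  have hb : conjInv (conjInv f * f) = conjInv f * f := by rw [conjInv_mul, conjInv_conjInv]
  induction k with
  | zero => simpa [succPow] using norm_sq_le_norm_conjInv_mul_self_one f g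
  | succ k ih =>
    have hk : 2 ^ (k + 1) - 1 = 2 * (2 ^ k - 1) + 1 := by
      have := Nat.one_le_two_pow (n := k)
      omega
    rw [hk, succPow_two_mul_add_one]
    have h := norm_sq_le_norm_conjInv_mul_self_one (succPow (conjInv f * f) (2 ^ k - 1)) 1
    rw [conjInv_succPow hb] at h
    refine le_trans ?_ h
    rw [pow_succ 2 k, pow_mul]
    exact pow_le_pow_left₀ (by positivity) ih 2

end group

end EllOne

/-! ### The minimum ideal of a compact right topological semigroup -/

section minimumIdeal

variable {M : Type u} [Semigroup M]

theorem mul_mem_minimumIdeal_left (s : M) {t : M} (ht : t ∈ minimumIdeal M) :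
    s * t ∈ minimumIdeal M :=
  fun I hI => hI.mul_mem_left s t (ht I hI)

theorem mul_mem_minimumIdeal_right {t : M} (ht : t ∈ minimumIdeal M) (s : M) :
    t * s ∈ minimumIdeal M :=
  fun I hI => hI.mul_mem_right s t (ht I hI)

/-- A compact right topological semigroup contains an idempotent `e` generating a minimal left
ideal: `e ∈ M * x` for every `x ∈ M * e`. -/
theorem exists_minimal_idempotent [Nonempty M] [TopologicalSpace M] [CompactSpace M] [T2Space M]
    (hM : ∀ r : M, Continuous (· * r)) :
    ∃ e : M, e * e = e ∧ ∀ x, ∃ t, t * (x * e) = e := by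
  let S : Set (Set M) := {N | IsClosed N ∧ N.Nonempty ∧ ∀ s, ∀ t ∈ N, s * t ∈ N}
  obtain ⟨N, hN⟩ : ∃ N, Minimal (· ∈ S) N := by
    refine zorn_superset _ fun c hcs hc => ?_
    refine ⟨⋂₀ c, ⟨isClosed_sInter fun t ht => (hcs ht).1, ?_, fun s t ht u hu =>
      (hcs hu).2.2 s t (ht u hu)⟩, fun s hs => Set.sInter_subset_of_mem hs⟩
    obtain rfl | hne := c.eq_empty_or_nonempty
    · rw [Set.sInter_empty]
      exact Set.univ_nonempty
    rw [Set.sInter_eq_iInter]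
    have : Nonempty c := hne.coe_sort
    exact IsCompact.nonempty_iInter_of_directed_nonempty_isCompact_isClosed ((↑) : c → Set M)
      (DirectedOn.directed_val (IsChain.directedOn hc.symm)) (fun i => (hcs i.prop).2.1)
      (fun i => (hcs i.prop).1.isCompact) (fun i => (hcs i.prop).1)
  obtain ⟨hcl, hne, hmul⟩ := hN.prop
  obtain ⟨e, heN, he⟩ := exists_idempotent_in_compact_subsemigroup hM N hne hcl.isCompact
    fun x _ y hy => hmul x y hy
  refine ⟨e, he, fun x => ?_⟩
  have hxe : x * e ∈ N := hmul x e heN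
  have hsub : Set.range (· * (x * e)) ⊆ N := by
    rintro _ ⟨t, rfl⟩
    exact hmul t _ hxe
  have hmem : Set.range (· * (x * e)) ∈ S := by
    refine ⟨(isCompact_range (hM _)).isClosed, Set.range_nonempty _, ?_⟩
    rintro s _ ⟨t, rfl⟩
    exact ⟨s * t, mul_assoc _ _ _⟩
  have h := hN.eq_of_subset hmem hsub
  rw [← h] at heN
  exact heN

theorem mem_minimumIdeal_of_minimal {e : M} (hmin : ∀ x, ∃ t, t * (x * e) = e) :
    e ∈ minimumIdeal M := by
  intro I hI
  obtain ⟨i, hi⟩ := hI.nonempty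
  obtain ⟨t, ht⟩ := hmin i
  rw [← ht]
  exact hI.mul_mem_left _ _ (hI.mul_mem_right _ _ hi)

theorem exists_eq_mul_mul_of_mem_minimumIdeal (e : M) {p : M} (hp : p ∈ minimumIdeal M) :
    ∃ a b, p = a * e * b := by
  refine hp {p | ∃ a b, p = a * e * b} ⟨⟨e * e * e, e, e, rfl⟩, ?_, ?_⟩
  · rintro s _ ⟨a, b, rfl⟩
    exact ⟨s * a, b, by simp only [mul_assoc]⟩
  · rintro s _ ⟨a, b, rfl⟩
    exact ⟨a, b * s, by simp only [mul_assoc]⟩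

/-- The corner `e * M * e` of a semigroup at an idempotent `e`. -/
def Corner (e : M) : Type u := {x : M // e * x = x ∧ x * e = x}

theorem exists_corner_inv {e : M} (he : e * e = e) (hmin : ∀ x, ∃ t, t * (x * e) = e)
    (x : Corner e) :
    ∃ y : Corner e, y.1 * x.1 = e := by
  obtain ⟨t, ht⟩ := hmin x.1
  refine ⟨⟨e * t * e, by simp only [← mul_assoc, he], by simp only [mul_assoc, he]⟩, ?_⟩
  rw [x.2.2] at ht
  change e * t * e * x.1 = e
  rw [mul_assoc, x.2.1, mul_assoc, ht, he]

/-- The corner at an idempotent generating a minimal left ideal is a group. -/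
@[reducible]
noncomputable def cornerGroup {e : M} (he : e * e = e) (hmin : ∀ x, ∃ t, t * (x * e) = e) :
    Group (Corner e) :=
  @Group.ofLeftAxioms (Corner e)
    ⟨fun x y => ⟨x.1 * y.1, by rw [← mul_assoc, x.2.1], by rw [mul_assoc, y.2.2]⟩⟩
    ⟨fun x => (exists_corner_inv he hmin x).choose⟩ ⟨⟨e, he, he⟩⟩
    (fun _ _ _ => Subtype.ext (mul_assoc _ _ _)) (fun x => Subtype.ext x.2.1)
    (fun x => Subtype.ext (exists_corner_inv he hmin x).choose_spec)

end minimumIdeal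

/-! ### The radical on the minimum ideal -/

namespace EllOne

variable {M : Type u} [Semigroup M]

theorem exists_norm_succPow_lt {a : EllOne M} (ha : a ∈ jacobsonRadical (EllOne M)) {c : ℝ}
    (hc : 0 < c) : ∃ k : ℕ, ‖succPow a (2 ^ k - 1)‖ < c ^ 2 ^ k :=
  let _ : NonUnitalNormedRing (EllOne M) := nonUnitalNormedRing
  exists_norm_succPow_lt_of_mem_jacobsonRadical ha hc

/-- The algebra `ℓ¹(G)` of a subgroup `G` of `M` contains no non-zero element of the radical of
`ℓ¹(M)`: if `h ≠ 0` in `ℓ¹(G)`, then `h^* * h` is not quasi-nilpotent. -/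
theorem eq_zero_of_map_mem_jacobsonRadical {G : Type u} [Group G] {i : G → M} (hi : i.Injective)
    (hmul : ∀ x y, i (x * y) = i x * i y) {h : EllOne G}
    (hJ : map i hi h ∈ jacobsonRadical (EllOne M)) : h = 0 := by
  by_contra hne
  obtain ⟨g, hg⟩ : ∃ g, h g ≠ 0 := by
    by_contra! hc
    exact hne (ext' hc)
  have ha : map i hi (conjInv h * h) ∈ jacobsonRadical (EllOne M) := by
    rw [map_mul_of_hom hi hmul]
    exact jacobsonRadical_mul_left _ hJ
  obtain ⟨k, hk⟩ := exists_norm_succPow_lt ha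
    (show 0 < ‖h g‖ ^ 2 by positivity)
  have hpow : ∀ n, succPow (map i hi (conjInv h * h)) n = map i hi (succPow (conjInv h * h) n) := by
    intro n
    induction n with
    | zero => rfl
    | succ n ih => rw [succPow, ih, succPow, map_mul_of_hom hi hmul (succPow _ n)]
  refine absurd (pow_le_norm_succPow_one h g k) (not_le.2 (lt_of_le_of_lt ?_ hk))
  rw [hpow, ← map_apply hi]
  exact norm_apply_le _ _

theorem delta_mul_apply_of_ne {e : M} (f : EllOne M) {t : M} (ht : ∀ x, e * x ≠ t) :
    (delta e * f) t = 0 := by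
  by_contra hne
  obtain ⟨x, y, hx, -, rfl⟩ := exists_of_mul_apply_ne_zero hne
  by_cases hxe : x = e
  · exact ht y (by rw [hxe])
  · exact hx (delta_apply_of_ne hxe)

theorem mul_delta_apply_of_ne {e : M} (f : EllOne M) {t : M} (ht : ∀ x, x * e ≠ t) :
    (f * delta e) t = 0 := by
  by_contra hne
  obtain ⟨x, y, -, hy, rfl⟩ := exists_of_mul_apply_ne_zero hne
  by_cases hye : y = e
  · exact ht x (by rw [hye])
  · exact hy (delta_apply_of_ne hye)

/-- The elements of the radical are annihilated by `f ↦ δ_p * f * δ_q` for `p, q` in the minimum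
ideal: writing `p = a * e * b` and `q = c * e * d` with a minimal idempotent `e`, the element
`δ_e * δ_b * f * δ_c * δ_e` of the radical lives on the group `e * M * e`. -/
theorem delta_mul_mul_delta_eq_zero [Nonempty M] [TopologicalSpace M] [CompactSpace M] [T2Space M]
    (hM : ∀ r : M, Continuous (· * r)) {f : EllOne M} (hf : f ∈ jacobsonRadical (EllOne M))
    {p q : M} (hp : p ∈ minimumIdeal M) (hq : q ∈ minimumIdeal M) :
    delta p * f * delta q = 0 := by
  obtain ⟨e, he, hmin⟩ := exists_minimal_idempotent hM
  obtain ⟨a, b, rfl⟩ := exists_eq_mul_mul_of_mem_minimumIdeal e hp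
  obtain ⟨c, d, rfl⟩ := exists_eq_mul_mul_of_mem_minimumIdeal e hq
  let _ : Group (Corner e) := cornerGroup he hmin
  let i : Corner e → M := Subtype.val
  have hi : i.Injective := Subtype.val_injective
  set F : EllOne M := delta e * (delta b * f * delta c) * delta e with hF
  have hFJ : F ∈ jacobsonRadical (EllOne M) :=
    jacobsonRadical_mul_right (jacobsonRadical_mul_left _
      (jacobsonRadical_mul_right (jacobsonRadical_mul_left _ hf) _)) _
  have hFi : map i hi (comap i hi F) = F := by
    refine ext' fun t => ?_
    by_cases ht : t ∈ Set.range i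
    · obtain ⟨x, rfl⟩ := ht
      rw [map_apply, comap_apply]
    · rw [map_apply_of_notMem hi _ ht]
      by_cases h1 : e * t = t
      · have h2 : t * e ≠ t := fun h2 => ht ⟨⟨t, h1, h2⟩, rfl⟩
        exact (mul_delta_apply_of_ne _ fun x hx => h2 (by rw [← hx, mul_assoc, he])).symm
      · rw [hF, mul_assoc (delta e)]
        exact (delta_mul_apply_of_ne _ fun x hx => h1 (by rw [← hx, ← mul_assoc, he])).symm
  have hF0 : F = 0 := by
    rw [← hFi] at hFJ ⊢
    rw [eq_zero_of_map_mem_jacobsonRadical hi (fun _ _ => rfl) hFJ]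
    refine ext' fun t => ?_
    by_contra hne
    obtain ⟨x, -, hx⟩ := exists_of_map_apply_ne_zero hi _ hne
    exact hx rfl
  have h : delta (a * e * b) * f * delta (c * e * d) = delta a * F * delta d := by
    simp only [hF, ← delta_mul_delta, mul_assoc]
  rw [h, hF0, mul_zero, zero_mul]

/-! ### The sufficiency of the condition -/

/-- If `f` is supported on `K` and `δ_p * f * δ_q = 0` for `p, q ∈ K`, then every `y * f`, with `y`
in the unitization, has cube zero, as `(y * f) ^ 3 = (y * f * y) * f * (y * f)`. -/
theorem pow_three_eq_zero {K : Set M} (hl : ∀ s, ∀ t ∈ K, s * t ∈ K)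
    (hr : ∀ s, ∀ t ∈ K, t * s ∈ K) {f : EllOne M} (hfK : supp f ⊆ K)
    (hf : ∀ p ∈ K, ∀ q ∈ K, delta p * f * delta q = 0) (y : Unitization ℂ (EllOne M)) :
    (y * (f : Unitization ℂ (EllOne M))) ^ 3 = 0 := by
  have hadd : ∀ {c : ℂ} {a b : EllOne M}, supp a ⊆ K → supp b ⊆ K → supp (c • a + b) ⊆ K := by
    intro c a b ha hb t ht
    by_cases hat : a t = 0
    · refine hb fun hbt => ht ?_
      rw [add_apply, smul_apply, hat, hbt, mul_zero, add_zero]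
    · exact ha hat
  induction y using Unitization.ind with | inl_add_inr c g =>
  set y : Unitization ℂ (EllOne M) := Unitization.inl c + (g : Unitization ℂ (EllOne M)) with h1
  set a : EllOne M := c • f + g * f with ha
  have haK : supp a ⊆ K := hadd hfK (supp_mul_subset_of_left hl g hfK)
  have h2 : y * (f : Unitization ℂ _) = (a : Unitization ℂ _) := by
    rw [h1, add_mul, Unitization.inl_mul_inr, ← Unitization.inr_mul, ← Unitization.inr_add]
  have h3 : (a : Unitization ℂ (EllOne M)) * y =
      ((c • a + a * g : EllOne M) : Unitization ℂ _) := by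
    rw [h1, mul_add, Unitization.inr_mul_inl, ← Unitization.inr_mul, ← Unitization.inr_add]
  have h4 : supp (c • a + a * g) ⊆ K := hadd haK (supp_mul_subset_of_right hr g haK)
  calc (y * (f : Unitization ℂ (EllOne M))) ^ 3
      = (y * (f : Unitization ℂ (EllOne M))) * y * f *
          (y * (f : Unitization ℂ (EllOne M))) := by
        rw [pow_succ, pow_two]
        simp only [mul_assoc]
    _ = (((c • a + a * g) * f * a : EllOne M) : Unitization ℂ (EllOne M)) := by
        rw [h2, h3, ← Unitization.inr_mul, ← Unitization.inr_mul]
    _ = 0 := by rw [mul_mul_eq_zero_of_supp_subset hf h4 haK, Unitization.inr_zero]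

theorem mem_jacobsonRadical_of_forall_pow_three {A : Type u} [NonUnitalRing A] [Module ℂ A]
    [IsScalarTower ℂ A A] [SMulCommClass ℂ A A] {f : A}
    (hf : ∀ y : Unitization ℂ A, (y * (f : Unitization ℂ A)) ^ 3 = 0) : f ∈ jacobsonRadical A := by
  rw [mem_jacobsonRadical_iff, Ideal.mem_jacobson_iff]
  intro y
  obtain ⟨u, hu⟩ := IsNilpotent.isUnit_one_add ⟨3, hf y⟩
  refine ⟨↑u⁻¹, ?_⟩
  have h : (↑u⁻¹ : Unitization ℂ A) * y * f + ↑u⁻¹ = ↑u⁻¹ * ↑u := by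
    rw [hu]
    noncomm_ring
  rw [h, Units.inv_mul, sub_self]
  exact Ideal.zero_mem _

end EllOne

/-! ### Translates and limits in the semigroup of ultrafilters on a group -/

namespace Ultrafilter

attribute [local instance] Ultrafilter.semigroup

section semigroup

variable {G : Type u} [Semigroup G] {I : Type*}

theorem mem_pure_mul {g : G} {v : Ultrafilter G} {A : Set G} :
    A ∈ pure g * v ↔ (g * ·) ⁻¹' A ∈ v := Iff.rfl

theorem pure_mul_pure (g h : G) : (pure g * pure h : Ultrafilter G) = pure (g * h) := rfl

/-- `map h z * r` is the limit of `h i * r` along `z`. -/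
theorem mem_map_mul {h : I → G} {z : Ultrafilter I} {r : Ultrafilter G} {A : Set G} :
    A ∈ map h z * r ↔ ∀ᶠ i in z, A ∈ pure (h i) * r := Iff.rfl

theorem pure_mul_map_mul (g : G) (h : I → G) (z : Ultrafilter I) (r : Ultrafilter G) :
    pure g * (map h z * r) = map (fun i => g * h i) z * r := by
  rw [← mul_assoc]
  rfl

/-- A point of the closure of `{k j * s : j ∈ W}` is a limit of `k j * s` along an ultrafilter
containing `W`. -/
theorem exists_eq_map_mul (k : I → G) {s v : Ultrafilter G} {W : Set I}
    (H : ∀ A ∈ v, ∃ j ∈ W, A ∈ pure (k j) * s) : ∃ z : Ultrafilter I, W ∈ z ∧ v = map k z * s := by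
  have hv : v ∈ closure ((fun j => pure (k j) * s) '' W) := by
    rw [ultrafilterBasis_is_basis.mem_closure_iff]
    rintro _ ⟨A, rfl⟩ hA
    obtain ⟨j, hj, hjA⟩ := H A hA
    exact ⟨_, hjA, j, hj, rfl⟩
  obtain ⟨u, hu, huv⟩ := mem_closure_iff_ultrafilter.1 hv
  refine ⟨ofComapInfPrincipal hu, ofComapInfPrincipal_mem hu, (coe_le_coe.1 fun A hA => ?_).symm⟩
  have h1 : {w : Ultrafilter G | A ∈ w} ∈ u := huv ((ultrafilter_isOpen_basic A).mem_nhds hA)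
  rw [← ofComapInfPrincipal_eq_of_map hu] at h1
  exact h1

/-- If the closures of two countable sets of translates meet, then an element of one of the sets
lies in the closure of the other. The sets of the indices may be shrunk to given members of the
ultrafilters. -/
theorem exists_of_map_mul_eq {J : Type*} [Countable I] [Countable J] (h : I → G) (k : J → G)
    {z₁ : Ultrafilter I} {z₂ : Ultrafilter J} {r s : Ultrafilter G}
    (heq : map h z₁ * r = map k z₂ * s) {U : Set I} {W : Set J} (hU : U ∈ z₁) (hW : W ∈ z₂) :
    (∃ i ∈ U, ∃ z : Ultrafilter J, W ∈ z ∧ pure (h i) * r = map k z * s) ∨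
      ∃ j ∈ W, ∃ z : Ultrafilter I, U ∈ z ∧ pure (k j) * s = map h z * r := by
  by_contra! hc
  have hA : ∀ i, ∃ A : Set G, i ∈ U → A ∈ pure (h i) * r ∧ ∀ j ∈ W, A ∉ pure (k j) * s := by
    intro i
    by_contra! hi
    obtain ⟨z, hz, hz'⟩ := exists_eq_map_mul k fun A hA => (hi A).2 hA
    exact hc.1 i (hi ∅).1 z hz hz'
  have hB : ∀ j, ∃ B : Set G, j ∈ W → B ∈ pure (k j) * s ∧ ∀ i ∈ U, B ∉ pure (h i) * r := by
    intro j
    by_contra! hj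
    obtain ⟨z, hz, hz'⟩ := exists_eq_map_mul h fun B hB => (hj B).2 hB
    exact hc.2 j (hj ∅).1 z hz hz'
  choose A hA using hA
  choose B hB using hB
  obtain ⟨e, he⟩ := Countable.exists_injective_nat I
  obtain ⟨d, hd⟩ := Countable.exists_injective_nat J
  -- Disjointify the two countable families of sets, in the order of the enumerations.
  let A' : I → Set G := fun i => A i ∩ ⋂ j ∈ {j | j ∈ W ∧ d j ≤ e i}, (B j)ᶜ
  let B' : J → Set G := fun j => B j ∩ ⋂ i ∈ {i | i ∈ U ∧ e i ≤ d j}, (A i)ᶜ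
  have hA' : ∀ i ∈ U, A' i ∈ pure (h i) * r := fun i hi => by
    refine inter_mem (hA i hi).1 ((biInter_mem ?_).2 fun j hj =>
      compl_mem_iff_notMem.2 ((hB j hj.1).2 i hi))
    exact ((Set.finite_Iic (e i)).preimage hd.injOn).subset fun j hj => hj.2
  have hB' : ∀ j ∈ W, B' j ∈ pure (k j) * s := fun j hj => by
    refine inter_mem (hB j hj).1 ((biInter_mem ?_).2 fun i hi =>
      compl_mem_iff_notMem.2 ((hA i hi.1).2 j hj))
    exact ((Set.finite_Iic (d j)).preimage he.injOn).subset fun i hi => hi.2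
  have h1 : (⋃ i ∈ U, A' i) ∈ map h z₁ * r := by
    rw [mem_map_mul]
    filter_upwards [hU] with i hi
    exact mem_of_superset (hA' i hi) (Set.subset_biUnion_of_mem hi)
  have h2 : (⋃ j ∈ W, B' j) ∈ map k z₂ * s := by
    rw [mem_map_mul]
    filter_upwards [hW] with j hj
    exact mem_of_superset (hB' j hj) (Set.subset_biUnion_of_mem hj)
  rw [← heq] at h2
  obtain ⟨x, hx1, hx2⟩ := nonempty_of_mem (inter_mem h1 h2)
  simp only [Set.mem_iUnion] at hx1 hx2
  obtain ⟨i, hi, hxA, hxi⟩ := hx1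
  obtain ⟨j, hj, hxB, hxj⟩ := hx2
  rcases le_total (d j) (e i) with hle | hle
  · exact Set.mem_iInter₂.1 hxi j ⟨hj, hle⟩ hxB
  · exact Set.mem_iInter₂.1 hxj i ⟨hi, hle⟩ hxA

end semigroup

section group

variable {G : Type u} [CommGroup G]

theorem pure_mul_comm (g : G) (v : Ultrafilter G) : pure g * v = v * pure g := by
  refine Ultrafilter.ext fun A => ?_
  change (∀ᶠ x in v, g * x ∈ A) ↔ ∀ᶠ x in v, x * g ∈ A
  simp only [mul_comm]

theorem one_mul' (v : Ultrafilter G) : pure 1 * v = v := by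
  refine Ultrafilter.ext fun A => ?_
  rw [mem_pure_mul]
  simp

theorem pure_mul_eq_iff {g : G} {u v : Ultrafilter G} : pure g * u = v ↔ u = pure g⁻¹ * v := by
  constructor
  · rintro rfl
    rw [← mul_assoc, pure_mul_pure, inv_mul_cancel, one_mul']
  · rintro rfl
    rw [← mul_assoc, pure_mul_pure, mul_inv_cancel, one_mul']

theorem pure_mul_mul_pure_mul (x y : G) (u v : Ultrafilter G) :
    pure x * u * (pure y * v) = pure (x * y) * (u * v) := by
  rw [← pure_mul_pure, mul_assoc, ← mul_assoc u, ← pure_mul_comm y u]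
  simp only [mul_assoc]

/-- A group acts freely on its ultrafilters by translation. On each coset of the cyclic group
generated by `g`, translation by `g` is addition of `1` to an exponent; for infinite order the
parity of the exponent separates `u` from `g * u`, and for finite order the power of `g` has a
limit along `u`. -/
theorem eq_one_of_pure_mul_eq {g : G} {u : Ultrafilter G} (h : pure g * u = u) : g = 1 := by
  have hk : ∀ x : G, ∃ k : ℤ, x = (x : G ⧸ Subgroup.zpowers g).out * g ^ k := fun x => by
    obtain ⟨⟨y, k, rfl⟩, hy⟩ := QuotientGroup.mk_out_eq_mul (Subgroup.zpowers g) x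
    refine ⟨-k, ?_⟩
    rw [hy]
    simp
  choose k hk using hk
  have hstep : ∀ x, g ^ k (g * x) = g * g ^ k x := fun x => by
    have hq : ((g * x : G) : G ⧸ Subgroup.zpowers g) = x := by
      rw [QuotientGroup.eq]
      refine ⟨-1, ?_⟩
      simp [mul_comm]
    have h1 := hk (g * x)
    rw [hq] at h1
    have h2 : g * x = (x : G ⧸ Subgroup.zpowers g).out * (g * g ^ k x) := by
      conv_lhs => rw [hk x]
      exact mul_left_comm _ _ _
    exact mul_left_cancel (h1.symm.trans h2)
  have htrans : ∀ A : Set G, A ∈ u ↔ (g * ·) ⁻¹' A ∈ u := fun A => by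
    conv_lhs => rw [← h]
    exact mem_pure_mul
  by_cases hfin : IsOfFinOrder g
  · obtain ⟨a, -, ha⟩ := eq_pure_of_finite_mem (f := map (fun x => g ^ k x) u)
      (finite_zpowers.2 hfin)
      (mem_map.2 (Filter.univ_mem' fun x => ⟨k x, rfl⟩))
    have hmem : {x | g ^ k x = a} ∈ u := by
      have : {a} ∈ map (fun x => g ^ k x) u := by rw [ha]; exact mem_pure.2 rfl
      exact this
    obtain ⟨x, hx, hx'⟩ := nonempty_of_mem (inter_mem hmem ((htrans _).1 hmem))
    have hx2 : g ^ k (g * x) = a := hx'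
    rw [hstep, show g ^ k x = a from hx] at hx2
    exact mul_eq_right.1 hx2
  · exfalso
    have hinj := injective_zpow_iff_not_isOfFinOrder.2 hfin
    have hk1 : ∀ x, k (g * x) = k x + 1 := fun x => hinj (by
      simp only [hstep, zpow_add, zpow_one, mul_comm])
    have hE : {x | Even (k x)} ∈ u ↔ {x | Even (k x)} ∉ u := by
      refine (htrans _).trans (Iff.trans (iff_of_eq (congrArg (· ∈ u) ?_)) compl_mem_iff_notMem)
      ext x
      simp [hk1]
    exact iff_not_self hE

end group

theorem eq_of_forall_inter_nonempty {α : Type*} {u v : Ultrafilter α}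
    (h : ∀ A ∈ u, ∀ B ∈ v, (A ∩ B).Nonempty) : u = v := by
  refine coe_le_coe.1 fun B hB => ?_
  by_contra hBu
  obtain ⟨x, hx, hx'⟩ := h _ (compl_mem_iff_notMem.2 hBu) B hB
  exact hx hx'

/-! ### Sequences chosen along an ultrafilter -/

/-- Along an ultrafilter one can choose a sequence whose terms eventually have each of countably
many properties of members, and each of countably many relations to the earlier terms. -/
theorem exists_seq_eventually {α κ κ' : Type*} [Countable κ] [Countable κ'] (x : Ultrafilter α)
    (P : κ → α → Prop) (hP : ∀ i, ∀ᶠ a in x, P i a) (Q : κ' → α → α → Prop)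
    (hQ : ∀ i a, ∀ᶠ b in x, Q i a b) :
    ∃ h : ℕ → α, (∀ i, ∀ᶠ n in atTop, P i (h n)) ∧
      ∀ i, ∀ᶠ n in atTop, ∀ m < n, Q i (h m) (h n) := by
  obtain ⟨e, he⟩ := Countable.exists_injective_nat κ
  obtain ⟨d, hd⟩ := Countable.exists_injective_nat κ'
  obtain ⟨f, hf1, hf2⟩ := exists_seq_of_forall_finset_exists
    (fun y : ℕ × α => ∀ i, e i ≤ y.1 → P i y.2)
    (fun y y' : ℕ × α => y.1 < y'.1 ∧ ∀ i, d i ≤ y'.1 → Q i y.2 y'.2) (fun s _ => by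
      set N := s.sup Prod.fst + 1
      have h1 : ∀ᶠ b in x, ∀ i ∈ {i | e i ≤ N}, P i b :=
        (eventually_all_finite ((Set.finite_Iic N).preimage he.injOn)).2 fun i _ => hP i
      have h2 : ∀ᶠ b in x, ∀ y ∈ (s : Set (ℕ × α)), ∀ i ∈ {i | d i ≤ N}, Q i y.2 b :=
        (eventually_all_finite s.finite_toSet).2 fun y _ =>
          (eventually_all_finite ((Set.finite_Iic N).preimage hd.injOn)).2 fun i _ => hQ i y.2
      obtain ⟨b, hb1, hb2⟩ := (h1.and h2).exists
      exact ⟨(N, b), hb1, fun y hy => ⟨Nat.lt_succ_of_le (Finset.le_sup (f := Prod.fst) hy),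
        hb2 y hy⟩⟩)
  have hmono : StrictMono fun n => (f n).1 := fun m n hmn => (hf2 m n hmn).1
  refine ⟨fun n => (f n).2, fun i => ?_, fun i => ?_⟩
  · filter_upwards [eventually_ge_atTop (e i)] with n hn
    exact hf1 n i (hn.trans (hmono.id_le n))
  · filter_upwards [eventually_ge_atTop (d i)] with n hn m hm
    exact (hf2 m n hm).2 i (hn.trans (hmono.id_le n))

theorem le_atTop_or_eq_pure (z : Ultrafilter ℕ) : (z : Filter ℕ) ≤ atTop ∨ ∃ n, z = pure n := by
  rw [← Nat.cofinite_eq_atTop]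
  exact z.le_cofinite_or_eq_pure

/-- Countably many free ultrafilters on `ℕ` can be avoided by an infinite set: of the uncountably
many pairwise almost disjoint branches of the binary tree, each of them contains at most one. -/
theorem exists_infinite_forall_notMem {Z : Set (Ultrafilter ℕ)} (hZ : Z.Countable)
    (hfree : ∀ z ∈ Z, (z : Filter ℕ) ≤ atTop) : ∃ E : Set ℕ, E.Infinite ∧ ∀ z ∈ Z, E ∉ z := by
  let b : (ℕ → Bool) → ℕ → ℕ := fun α n => Encodable.encode ((List.range n).map α)
  have hlen : ∀ {α β m n}, b α m = b β n → m = n ∧ ∀ i < m, α i = β i := by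
    intro α β m n h
    have h1 := Encodable.encode_injective h
    have h2 : m = n := by simpa using congrArg List.length h1
    subst h2
    exact ⟨rfl, fun i hi => by simpa using List.map_inj_left.1 h1 i (List.mem_range.2 hi)⟩
  by_contra! hc
  choose ζ hζ hbζ using fun α => hc (Set.range (b α))
    (Set.infinite_range_of_injective fun m n h => (hlen h).1)
  have hinj : Function.Injective fun α => (⟨ζ α, hζ α⟩ : Z) := by
    intro α β h
    by_contra hne
    obtain ⟨i, hi⟩ := Function.ne_iff.1 hne
    have hzz : ζ α = ζ β := congrArg Subtype.val h
    have hmem : Set.range (b α) ∩ Set.range (b β) ∈ ζ α :=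
      inter_mem (hbζ α) (by rw [hzz]; exact hbζ β)
    have hfin : (Set.range (b α) ∩ Set.range (b β)).Finite := by
      refine ((Set.finite_Iic i).image (b α)).subset ?_
      rintro _ ⟨⟨m, rfl⟩, ⟨n, hn⟩⟩
      exact ⟨m, not_lt.1 fun him => hi ((hlen hn.symm).2 i him), rfl⟩
    have hcof : (ζ α : Filter ℕ) ≤ cofinite := Nat.cofinite_eq_atTop ▸ hfree _ (hζ α)
    exact compl_mem_iff_notMem.1 (hcof hfin.compl_mem_cofinite) hmem
  have : Countable Z := hZ.to_subtype
  have : Countable (ℕ → Bool) := hinj.countable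
  obtain ⟨f, hf⟩ := exists_surjective_nat (ℕ → Bool)
  obtain ⟨n, hn⟩ := hf fun n => !f n n
  simpa using congrFun hn n

end Ultrafilter

/-! ### A translate with unique factorization -/

namespace Ultrafilter

attribute [local instance] Ultrafilter.semigroup

section separation

variable {G : Type u} [CommGroup G] {h : ℕ → G} {E : Set ℕ} {r s : Ultrafilter G}

/-- Neither of `r` and `s` lies in the left ideal generated by `q * s` or `q * r` respectively, for
any limit `q` of the sequence `h` along a free ultrafilter containing `E`. -/
def Separated (h : ℕ → G) (E : Set ℕ) (r s : Ultrafilter G) : Prop :=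
  ∀ z : Ultrafilter ℕ, (z : Filter ℕ) ≤ atTop → E ∈ z → ∀ w : Ultrafilter G,
    w * (map h z * r) ≠ s ∧ w * (map h z * s) ≠ r

theorem Separated.symm (H : Separated h E r s) : Separated h E s r :=
  fun z hz hE w => (H z hz hE w).symm

/-- An equality `g * q₁ * r = q₂ * s` between translates of limits `q₁, q₂` of `h` is witnessed by
equalities between terms of the sequence. -/
theorem Separated.exists_of_pure_mul_eq (H : Separated h E r s) {z₁ z₂ : Ultrafilter ℕ} {g : G}
    (hE₁ : E ∈ z₁) (hE₂ : E ∈ z₂) (heq : pure g * (map h z₁ * r) = map h z₂ * s)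
    {U₁ U₂ : Set ℕ} (hU₁ : U₁ ∈ z₁) (hU₂ : U₂ ∈ z₂) :
    ∃ n ∈ U₁, ∃ m ∈ U₂, pure (g * h n) * r = pure (h m) * s := by
  rw [pure_mul_map_mul] at heq
  rcases exists_of_map_mul_eq _ _ heq (inter_mem hU₁ hE₁) (inter_mem hU₂ hE₂) with
    ⟨n, hn, z, hz, hnz⟩ | ⟨m, hm, z, hz, hmz⟩
  · rcases le_atTop_or_eq_pure z with hfree | ⟨m, rfl⟩
    · exact absurd (pure_mul_eq_iff.1 hnz).symm
        (H z hfree (mem_of_superset hz Set.inter_subset_right) _).2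
    · exact ⟨n, hn.1, m, (mem_pure.1 hz).1, hnz⟩
  · rcases le_atTop_or_eq_pure z with hfree | ⟨n, rfl⟩
    · rw [← pure_mul_map_mul, pure_mul_eq_iff, ← mul_assoc] at hmz
      exact absurd hmz.symm (H z hfree (mem_of_superset hz Set.inter_subset_right) _).1
    · exact ⟨n, (mem_pure.1 hz).1, m, hm.1, hmz.symm⟩

/-- In an equality `y * q₁ * r = q₂ * s` the ultrafilter `y` contains translates carrying
`q₁ * r` to limits of `h` times `s`. -/
theorem Separated.exists_of_mul_eq [Countable G] (H : Separated h E r s) {z₁ z₂ : Ultrafilter ℕ}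
    (hz₁ : (z₁ : Filter ℕ) ≤ atTop) (hE₁ : E ∈ z₁) (hE₂ : E ∈ z₂) {y : Ultrafilter G}
    (heq : y * (map h z₁ * r) = map h z₂ * s) {Y : Set G} (hY : Y ∈ y) {U : Set ℕ} (hU : U ∈ z₂) :
    ∃ g ∈ Y, ∃ z : Ultrafilter ℕ, (z : Filter ℕ) ≤ atTop ∧ E ∈ z ∧ U ∈ z ∧
      pure g * (map h z₁ * r) = map h z * s := by
  rw [← map_id y] at heq
  rcases exists_of_map_mul_eq _ _ heq hY (inter_mem hU hE₂) with
    ⟨g, hg, z, hz, hgz⟩ | ⟨m, hm, w, hw, hmw⟩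
  · rcases le_atTop_or_eq_pure z with hfree | ⟨m, rfl⟩
    · exact ⟨g, hg, z, hfree, mem_of_superset hz Set.inter_subset_right,
        mem_of_superset hz Set.inter_subset_left, hgz⟩
    · have h1 : pure (h m) * s = pure g * (map h z₁ * r) := hgz.symm
      rw [pure_mul_eq_iff, ← mul_assoc] at h1
      exact absurd h1.symm (H z₁ hz₁ hE₁ _).1
  · rw [map_id, pure_mul_eq_iff, ← mul_assoc] at hmw
    exact absurd hmw.symm (H z₁ hz₁ hE₁ _).1

end separation

section sparse

variable {G : Type u} [CommGroup G] {h : ℕ → G} {p : Ultrafilter G}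

/-- If the quotients of distinct terms of `h` leave every finite set and `p` is not in the left
ideals generated by the `q * p`, for `q` a free limit of `h`, then a factorization
`y * (q * p)` determines `y` and the limit `q`. -/
theorem eq_and_eq_of_mul_eq [Countable G]
    (hh : ∀ g, ∃ N, ∀ n ≥ N, ∀ m ≥ N, h m = g * h n → m = n)
    (H : Separated h Set.univ p p) {z₁ z₂ : Ultrafilter ℕ} (hz₁ : (z₁ : Filter ℕ) ≤ atTop)
    (hz₂ : (z₂ : Filter ℕ) ≤ atTop) {y y' : Ultrafilter G}
    (heq : y * (map h z₁ * p) = y' * (map h z₂ * p)) : z₁ = z₂ ∧ y = y' := by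
  -- the case of two principal factors
  have h1 : ∀ {z₁ z₂ : Ultrafilter ℕ}, (z₁ : Filter ℕ) ≤ atTop → (z₂ : Filter ℕ) ≤ atTop →
      ∀ {g : G}, pure g * (map h z₁ * p) = map h z₂ * p → g = 1 ∧ z₁ = z₂ := by
    intro z₁ z₂ hz₁ hz₂ g hg
    obtain ⟨N, hN⟩ := hh g
    have key : ∀ A ∈ z₁, ∀ B ∈ z₂, g = 1 ∧ (A ∩ B).Nonempty := by
      intro A hA B hB
      obtain ⟨n, ⟨hnA, hnN⟩, m, ⟨hmB, hmN⟩, hnm⟩ := H.exists_of_pure_mul_eq univ_mem univ_mem hg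
        (inter_mem hA (hz₁ (Ici_mem_atTop N))) (inter_mem hB (hz₂ (Ici_mem_atTop N)))
      rw [pure_mul_eq_iff, ← mul_assoc, pure_mul_pure] at hnm
      have hnm' : h m = g * h n := (inv_mul_eq_one.1 (eq_one_of_pure_mul_eq hnm.symm)).symm
      obtain rfl := hN n hnN m hmN hnm'
      exact ⟨right_eq_mul.1 hnm', m, hnA, hmB⟩
    exact ⟨(key _ univ_mem _ univ_mem).1,
      eq_of_forall_inter_nonempty fun A hA B hB => (key A hA B hB).2⟩
  -- the case of one principal factor
  have h2 : ∀ {z₁ z₂ : Ultrafilter ℕ}, (z₁ : Filter ℕ) ≤ atTop → (z₂ : Filter ℕ) ≤ atTop →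
      ∀ {y : Ultrafilter G}, y * (map h z₁ * p) = map h z₂ * p → z₁ = z₂ ∧ y = pure 1 := by
    intro z₁ z₂ hz₁ hz₂ y hy
    have key : ∀ Y ∈ y, ∀ U ∈ z₂, 1 ∈ Y ∧ U ∈ z₁ := by
      intro Y hY U hU
      obtain ⟨g, hgY, z, hz, -, hUz, hgz⟩ := H.exists_of_mul_eq hz₁ univ_mem univ_mem hy hY hU
      obtain ⟨rfl, rfl⟩ := h1 hz₁ hz hgz
      exact ⟨hgY, hUz⟩
    exact ⟨coe_le_coe.1 fun U hU => (key _ univ_mem U hU).2,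
      (coe_le_coe.1 fun Y hY => mem_pure.2 (key Y hY _ univ_mem).1).symm⟩
  have heq' := heq
  rw [← map_id y, ← map_id y'] at heq'
  have key : ∀ Y ∈ y, ∀ Y' ∈ y', z₁ = z₂ ∧ (Y ∩ Y').Nonempty := by
    intro Y hY Y' hY'
    rcases exists_of_map_mul_eq _ _ heq' hY hY' with ⟨g, hg, w, hw, hgw⟩ | ⟨g, hg, w, hw, hgw⟩
    · rw [map_id, id, pure_mul_eq_iff, ← mul_assoc] at hgw
      obtain ⟨hz, hw1⟩ := h2 hz₂ hz₁ hgw.symm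
      rw [pure_mul_eq_iff, inv_inv, pure_mul_pure, mul_one] at hw1
      subst hw1
      exact ⟨hz.symm, g, hg, mem_pure.1 hw⟩
    · rw [map_id, id, pure_mul_eq_iff, ← mul_assoc] at hgw
      obtain ⟨hz, hw1⟩ := h2 hz₁ hz₂ hgw.symm
      rw [pure_mul_eq_iff, inv_inv, pure_mul_pure, mul_one] at hw1
      subst hw1
      exact ⟨hz, g, mem_pure.1 hw, hg⟩
  exact ⟨(key _ univ_mem _ univ_mem).1,
      eq_of_forall_inter_nonempty fun A hA B hB => (key A hA B hB).2⟩

end sparse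

/-- Let `R` be a countable set of ultrafilters containing `p`, and suppose that `p` is outside the
left ideals generated by the elements `x * r` with `r ∈ R`. Then there is an ultrafilter `q`,
sharing given countably many members with `x`, such that `q * p` is right cancellable, and such that
the left ideals generated by `q * r` and `q * p` are disjoint for all `r ∈ R` except for translates
of `p`. -/
theorem exists_mul_right_cancellable {G : Type u} [CommGroup G] [Countable G]
    {p x : Ultrafilter G} {R : Set (Ultrafilter G)} (hR : R.Countable) (hpR : p ∈ R)
    (hx : ∀ y, ∀ r ∈ R, y * (x * r) ≠ p) {ι : Type*} [Countable ι] {C : ι → Set G}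
    (hC : ∀ i, C i ∈ x) :
    ∃ q : Ultrafilter G, (∀ i, C i ∈ q) ∧ (∀ y y', y * (q * p) = y' * (q * p) → y = y') ∧
      ∀ r ∈ R, ∀ y y', y * (q * r) = y' * (q * p) → ∃ g, r = pure g * p := by
  have : Countable R := hR.to_subtype
  -- By compactness, `p` has for each `r` a member outside all translates of `x * r`.
  have hA : ∀ r : R, ∃ A ∈ p, ∀ g, A ∉ pure g * (x * r.1) := by
    intro r
    by_contra! hc
    obtain ⟨z, -, hz⟩ := exists_eq_map_mul (id : G → G) (s := x * r.1) (v := p) (W := Set.univ)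
      fun A hA => (hc A hA).imp fun g hg => ⟨trivial, hg⟩
    exact hx _ r.1 r.2 hz.symm
  choose A hAp hA using hA
  have hxne : ∀ g, ∀ᶠ b in (x : Filter G), b ≠ g := by
    intro g
    by_contra hc
    rw [← eventually_not] at hc
    have hxg : x = pure g := (coe_le_coe.1 (by
      rw [coe_pure, le_pure_iff]
      filter_upwards [hc] with b hb
      exact not_not.1 hb))
    refine hx (pure g⁻¹) p hpR ?_
    rw [hxg, ← mul_assoc, pure_mul_pure, inv_mul_cancel, one_mul']
  obtain ⟨h, hP, hQ⟩ := exists_seq_eventually x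
    (fun (i : (R × G) ⊕ ι) b => Sum.elim (fun k => A k.1 ∉ pure (k.2 * b) * k.1.1)
      (fun i => b ∈ C i) i)
    (by
      rintro (⟨r, g⟩ | i)
      · have h1 := hA r g
        rw [← mul_assoc, ← compl_mem_iff_notMem] at h1
        filter_upwards [h1] with b hb
        exact compl_mem_iff_notMem.1 hb
      · exact hC i)
    (fun (g : G) a b => b ≠ g * a) (fun g a => hxne _)
  have hsparse : ∀ g, ∃ N, ∀ n ≥ N, ∀ m ≥ N, h m = g * h n → m = n := by
    intro g
    obtain ⟨N, hN⟩ := eventually_atTop.1 ((hQ g).and (hQ g⁻¹))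
    refine ⟨N, fun n hn m hm hmn => ?_⟩
    rcases lt_trichotomy m n with hlt | heq | hlt
    · exact absurd (eq_inv_mul_of_mul_eq hmn.symm) ((hN n hn).2 m hlt)
    · exact heq
    · exact absurd hmn ((hN m hm).1 n hlt)
  have hfar : ∀ z : Ultrafilter ℕ, (z : Filter ℕ) ≤ atTop → ∀ r ∈ R, ∀ w,
      w * (map h z * r) ≠ p := by
    intro z hz r hr w hw
    have h1 : A ⟨r, hr⟩ ∈ w * (map h z * r) := hw ▸ hAp ⟨r, hr⟩
    rw [← map_id w, mem_map_mul] at h1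
    obtain ⟨g, hg⟩ := h1.exists
    rw [pure_mul_map_mul, mem_map_mul] at hg
    obtain ⟨n, hn1, hn2⟩ := (hg.and (hz (hP (Sum.inl (⟨r, hr⟩, g))))).exists
    exact hn2 hn1
  have hsep : Separated h Set.univ p p := fun z hz _ w =>
    ⟨hfar z hz p hpR w, hfar z hz p hpR w⟩
  -- Every `r ∈ R` lies in the left ideal generated by `q * p` for at most one free limit `q`
  -- of `h`.
  obtain ⟨E, hEinf, hE⟩ := exists_infinite_forall_notMem
    (Z := ⋃ r ∈ R, {z : Ultrafilter ℕ | (z : Filter ℕ) ≤ atTop ∧ ∃ w, w * (map h z * p) = r})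
    (hR.biUnion fun r _ => Set.Subsingleton.countable fun z hz z' hz' => by
      obtain ⟨hz, w, hw⟩ := hz
      obtain ⟨hz', w', hw'⟩ := hz'
      exact (eq_and_eq_of_mul_eq hsparse hsep hz hz' (hw.trans hw'.symm)).1)
    (fun z hz => by
      obtain ⟨r, -, hz, -⟩ := Set.mem_iUnion₂.1 hz
      exact hz)
  have hsepE : ∀ r ∈ R, Separated h E r p := fun r hr z hz hEz w =>
    ⟨hfar z hz r hr w, fun hw => hE z (Set.mem_iUnion₂.2 ⟨r, hr, hz, w, hw⟩) hEz⟩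
  have hne : (atTop ⊓ 𝓟 E : Filter ℕ).NeBot := by
    rw [← Nat.cofinite_eq_atTop]
    exact cofinite_inf_principal_neBot_iff.2 hEinf
  obtain ⟨z₀, hz₀⟩ := exists_le (atTop ⊓ 𝓟 E : Filter ℕ)
  have hfree : (z₀ : Filter ℕ) ≤ atTop := hz₀.trans inf_le_left
  have hE₀ : E ∈ z₀ := hz₀ (mem_inf_of_right (mem_principal_self E))
  -- a translate of `q * p` or of `q * r` in the left ideal generated by the other
  have hfin : ∀ {r s : Ultrafilter G}, Separated h E r s → ∀ {g : G} {w : Ultrafilter G},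
      pure g * (map h z₀ * s) = w * (map h z₀ * r) → ∃ g, r = pure g * s := by
    intro r s hrs g w hgw
    rw [pure_mul_eq_iff, ← mul_assoc] at hgw
    obtain ⟨g', -, z, hz, hEz, -, hgz⟩ := hrs.exists_of_mul_eq hfree hE₀ hE₀ hgw.symm univ_mem
      univ_mem
    obtain ⟨n, -, m, -, hnm⟩ := hrs.exists_of_pure_mul_eq hE₀ hEz hgz univ_mem univ_mem
    rw [pure_mul_eq_iff, ← mul_assoc, pure_mul_pure] at hnm
    exact ⟨_, hnm⟩
  refine ⟨map h z₀, fun i => ?_, fun y y' hyy => ?_, fun r hr y y' hyy => ?_⟩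
  · exact hfree (hP (Sum.inr i))
  · exact (eq_and_eq_of_mul_eq hsparse hsep hfree hfree hyy).2
  · rw [← map_id y, ← map_id y'] at hyy
    rcases exists_of_map_mul_eq _ _ hyy univ_mem univ_mem with
      ⟨g, -, w, -, hgw⟩ | ⟨g, -, w, -, hgw⟩
    · obtain ⟨g', hg'⟩ := hfin (hsepE r hr).symm hgw
      exact ⟨g'⁻¹, pure_mul_eq_iff.1 hg'.symm⟩
    · exact hfin (hsepE r hr) hgw

end Ultrafilter

/-! ### The group of fractions of a cancellative commutative semigroup -/

/-- A cancellative commutative semigroup embeds into a commutative group of fractions. -/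
theorem exists_embedding_commGroup (S : Type u) [CommSemigroup S] [IsCancelMul S] [Countable S]
    [Nonempty S] : ∃ (G : Type u) (_ : CommGroup G) (_ : Countable G) (ι : S →ₙ* G),
      Function.Injective ι ∧ ∀ g, ∃ s t, g * ι t = ι s := by
  let G := Algebra.GrothendieckGroup (WithOne S)
  let of : WithOne S →* G := Algebra.GrothendieckGroup.of
  have hof : ∀ {a b : WithOne S}, of a = of b → ∃ c, c * a = c * b := fun {a b} hab => by
    obtain ⟨c, hc⟩ := (Submonoid.LocalizationMap.eq_iff_exists
      (Localization.monoidOf (⊤ : Submonoid (WithOne S)))).1 hab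
    exact ⟨c, hc⟩
  have : Countable (WithOne S) := inferInstanceAs (Countable (Option S))
  have hcount : Countable G := Function.Surjective.countable
    (f := fun x : WithOne S × (⊤ : Submonoid (WithOne S)) => Localization.mk x.1 x.2)
    fun y => Localization.induction_on y fun x => ⟨x, rfl⟩
  obtain ⟨s₀⟩ := ‹Nonempty S›
  refine ⟨G, inferInstance, hcount, ⟨fun s => of s, fun s t => ?_⟩, fun s t hst => ?_, fun g => ?_⟩
  · rw [WithOne.coe_mul, map_mul]
  · obtain ⟨c, hc⟩ := hof hst
    cases c with
    | one => simpa using hc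
    | coe c =>
      rw [← WithOne.coe_mul, ← WithOne.coe_mul, WithOne.coe_inj] at hc
      exact mul_left_cancel hc
  · have hfrac : ∃ a b : WithOne S, g * of b = of a := by
      obtain ⟨⟨a, b⟩, hab⟩ := (Localization.monoidOf (⊤ : Submonoid (WithOne S))).surj g
      exact ⟨a, b, hab⟩
    have hcoe : ∀ a : WithOne S, ∃ s : S, a * s₀ = s := fun a => by
      cases a with
      | one => exact ⟨s₀, one_mul _⟩
      | coe a => exact ⟨a * s₀, rfl⟩
    -- multiplying numerator and denominator by `s₀` moves them from `WithOne S` into `S`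
    obtain ⟨a, b, hab⟩ := hfrac
    obtain ⟨s, hs⟩ := hcoe a
    obtain ⟨t, ht⟩ := hcoe b
    refine ⟨s, t, ?_⟩
    change g * of t = of s
    rw [← hs, ← ht, map_mul, map_mul, ← mul_assoc, hab]

/-! ### The remainder inside the ultrafilters on a group -/

namespace StoneCechRemainder

attribute [local instance] Ultrafilter.semigroup

instance topologicalSpace (S : Type u) : TopologicalSpace (StoneCechRemainder S) :=
  inferInstanceAs (TopologicalSpace {p : Ultrafilter S // ∀ s : S, p ≠ pure s})

instance (S : Type u) : T2Space (StoneCechRemainder S) :=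
  inferInstanceAs (T2Space {p : Ultrafilter S // ∀ s : S, p ≠ pure s})

instance (S : Type u) : CompactSpace (StoneCechRemainder S) := by
  refine (isCompact_iff_compactSpace (s := {p : Ultrafilter S | ∀ s : S, p ≠ pure s})).1
    (IsClosed.isCompact ?_)
  rw [Set.ofPred_forall]
  refine isClosed_iInter fun s => ?_
  have h : {p : Ultrafilter S | p ≠ pure s} = {p | {s} ∈ p}ᶜ := by
    ext p
    refine not_congr ⟨fun h => ?_, fun h => ?_⟩
    · rw [h]
      exact Ultrafilter.mem_pure.2 rfl
    · obtain ⟨x, hx, rfl⟩ := Ultrafilter.eq_pure_of_finite_mem (Set.finite_singleton s) h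
      rw [Set.mem_singleton_iff.1 hx]
  rw [h]
  exact (ultrafilter_isOpen_basic _).isClosed_compl

theorem continuous_mul_left {S : Type u} [Semigroup S] [IsCancelMul S]
    (r : StoneCechRemainder S) : Continuous (· * r) :=
  ((Ultrafilter.continuous_mul_left r.1).comp continuous_subtype_val).subtype_mk _

section embedding

variable {S G : Type u} [Semigroup S] [CommGroup G] (ι : S →ₙ* G)

/-- The map `S* → βG` induced by a homomorphism `S → G`. -/
def toUltrafilter (p : StoneCechRemainder S) : Ultrafilter G := p.1.map ι

theorem toUltrafilter_mul [IsCancelMul S] (p q : StoneCechRemainder S) :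
    toUltrafilter ι (p * q) = toUltrafilter ι p * toUltrafilter ι q := by
  refine Ultrafilter.ext fun A => ?_
  change (∀ᶠ m in p.1, ∀ᶠ n in q.1, ι (m * n) ∈ A) ↔ ∀ᶠ m in p.1, ∀ᶠ n in q.1, ι m * ι n ∈ A
  simp only [map_mul]

variable {ι}

theorem toUltrafilter_injective (hι : Function.Injective ι) :
    Function.Injective (toUltrafilter ι) := fun p q hpq => by
  refine Subtype.ext (Ultrafilter.ext fun A => ?_)
  have h : ι '' A ∈ toUltrafilter ι p ↔ ι '' A ∈ toUltrafilter ι q := by rw [hpq]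
  simpa only [toUltrafilter, Ultrafilter.mem_map, Set.preimage_image_eq _ hι] using h

theorem toUltrafilter_ne_pure (hι : Function.Injective ι) (p : StoneCechRemainder S) (g : G) :
    toUltrafilter ι p ≠ pure g := by
  intro h
  have h1 : {g} ∈ toUltrafilter ι p := by
    rw [h]
    exact Ultrafilter.mem_pure.2 rfl
  obtain ⟨s, -, hs⟩ := Ultrafilter.eq_pure_of_finite_mem
    ((Set.finite_singleton g).preimage hι.injOn) (Ultrafilter.mem_map.1 h1)
  exact p.2 s hs

theorem range_mem_toUltrafilter (p : StoneCechRemainder S) :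
    Set.range ι ∈ toUltrafilter ι p :=
  Ultrafilter.mem_map.2 (Filter.univ_mem' fun s => ⟨s, rfl⟩)

theorem mem_range_toUltrafilter (hι : Function.Injective ι) {v : Ultrafilter G}
    (hv : Set.range ι ∈ v) (hv' : ∀ g, v ≠ pure g) : v ∈ Set.range (toUltrafilter ι) := by
  have h : (v.comap hι hv).map ι = v := by
    refine (Ultrafilter.coe_le_coe.1 fun A hA => ?_)
    rw [Ultrafilter.mem_coe, Ultrafilter.mem_map, Ultrafilter.mem_comap]
    exact mem_of_superset (inter_mem hA hv) fun x ⟨hxA, s, hs⟩ => ⟨s, by subst hs; exact hxA, hs⟩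
  refine ⟨⟨v.comap hι hv, fun s hs => hv' (ι s) ?_⟩, h⟩
  rw [← h, hs, Ultrafilter.map_pure]

variable (ι) in
/-- The ultrafilters on `G` all of whose translates lie in `S*`. They form a left ideal. -/
def divisible : Set (Ultrafilter G) := {d | ∀ g, pure g * d ∈ Set.range (toUltrafilter ι)}

theorem mem_divisible_iff (hι : Function.Injective ι) {d : Ultrafilter G} :
    d ∈ divisible ι ↔ (∀ g, {n | g * n ∈ Set.range ι} ∈ d) ∧ ∀ g, d ≠ pure g := by
  constructor
  · refine fun h => ⟨fun g => ?_, fun g hg => ?_⟩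
    · obtain ⟨p, hp⟩ := h g
      have := range_mem_toUltrafilter (ι := ι) p
      rw [hp] at this
      exact this
    · obtain ⟨p, hp⟩ := h 1
      rw [Ultrafilter.one_mul', hg] at hp
      exact toUltrafilter_ne_pure hι p g hp
  · refine fun h g => mem_range_toUltrafilter hι (h.1 g) ?_
    exact StoneCechRemainder.mul_ne_pure (pure g) d h.2

theorem mul_mem_divisible (hι : Function.Injective ι) (y : Ultrafilter G) {d : Ultrafilter G}
    (hd : d ∈ divisible ι) : y * d ∈ divisible ι := by
  rw [mem_divisible_iff hι] at hd ⊢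
  refine ⟨fun g => ?_, StoneCechRemainder.mul_ne_pure y d hd.2⟩
  change ∀ᶠ h in y, ∀ᶠ n in d, g * (h * n) ∈ Set.range ι
  refine Filter.univ_mem' fun h => ?_
  filter_upwards [hd.1 (g * h)] with n hn
  rw [← mul_assoc]
  exact hn

theorem mem_range_of_mem_divisible {d : Ultrafilter G} (hd : d ∈ divisible ι) :
    d ∈ Set.range (toUltrafilter ι) := by
  have h := hd 1
  rwa [Ultrafilter.one_mul'] at h

theorem divisible_nonempty (hι : Function.Injective ι) (hfrac : ∀ g, ∃ s t, g * ι t = ι s)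
    (p : StoneCechRemainder S) : (divisible ι).Nonempty := by
  obtain ⟨c, hc⟩ := Ultrafilter.exists_ultrafilter_of_finite_inter_nonempty
    (Set.range fun g : G => {n | g * n ∈ Set.range ι}) (fun T hT => by
      classical
      induction T using Finset.induction_on with
      | empty => simp
      | insert A T hA ih =>
        rw [Finset.coe_insert, Set.insert_subset_iff] at hT
        obtain ⟨h₀, hh₀⟩ := ih hT.2
        obtain ⟨g, rfl⟩ := hT.1
        obtain ⟨s, t, hst⟩ := hfrac (g * h₀)
        refine ⟨h₀ * ι t, ?_⟩
        rw [Finset.coe_insert, Set.sInter_insert]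
        refine ⟨⟨s, by rw [← hst, mul_assoc]⟩, fun B hB => ?_⟩
        obtain ⟨g', rfl⟩ := hT.2 hB
        obtain ⟨s', hs'⟩ := hh₀ _ hB
        exact ⟨s' * t, by rw [map_mul, hs', mul_assoc]⟩)
  refine ⟨c * toUltrafilter ι p, (mem_divisible_iff hι).2 ⟨fun g => ?_,
    StoneCechRemainder.mul_ne_pure _ _ (toUltrafilter_ne_pure hι p)⟩⟩
  have h1 : {n | g * n ∈ Set.range ι} ∈ c := hc ⟨g, rfl⟩
  change ∀ᶠ m in c, ∀ᶠ n in toUltrafilter ι p, g * (m * n) ∈ Set.range ι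
  filter_upwards [h1] with m hm
  filter_upwards [range_mem_toUltrafilter p] with n hn
  obtain ⟨s, hs⟩ := hm
  obtain ⟨t, rfl⟩ := hn
  exact ⟨s * t, by rw [map_mul, hs, mul_assoc]⟩

end embedding

end StoneCechRemainder

/-! ### The radical outside the minimum ideal -/

namespace EllOne

attribute [local instance] Ultrafilter.semigroup

open Ultrafilter

/-- Let `j : T → βG` be an injective homomorphism, and let `q ∈ βG` be such that the translates of
`q` lie in `T`, that `q * p` is right cancellable with `p = j p₀`, and that, for `r` in the support
of `f`, the left ideals generated by `q * j r` and `q * p` are disjoint unless `j r` is a translate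
of `p`. If `f` is in the radical of `ℓ¹(T)`, then `f p₀ = 0`.

With `h(g) = f(g * p)` in `ℓ¹(G)` and `u = ∑ h^*(g) δ_{g * q}`, the values of `(u * f) ^ n` on the
translates of `(q * p) ^ n` are those of `(h^* * h) ^ n`. -/
theorem apply_eq_zero_of_mem_jacobsonRadical {T G : Type u} [Semigroup T] [CommGroup G]
    {j : T → Ultrafilter G} (hj : j.Injective) (hjmul : ∀ x y, j (x * y) = j x * j y)
    {f : EllOne T} (hf : f ∈ jacobsonRadical (EllOne T)) {p₀ : T} {q : Ultrafilter G}
    (hq : ∀ g, pure g * q ∈ Set.range j)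
    (hcancel : ∀ y y', y * (q * j p₀) = y' * (q * j p₀) → y = y')
    (hsep : ∀ r, f r ≠ 0 → ∀ y y', y * (q * j r) = y' * (q * j p₀) → ∃ g, j r = pure g * j p₀) :
    f p₀ = 0 := by
  by_contra hne
  have hinj : ∀ v : Ultrafilter G, Function.Injective fun g : G => pure g * v := by
    intro v g g' hgg
    have h1 : pure g * v = pure g' * v := hgg
    rw [pure_mul_eq_iff, ← mul_assoc, Ultrafilter.pure_mul_pure] at h1
    exact inv_mul_eq_one.1 (eq_one_of_pure_mul_eq h1.symm)
  choose k hk using hq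
  have hkinj : k.Injective := fun g g' hgg => hinj q (by simp only [← hk, hgg])
  set p := j p₀ with hp
  set w := q * p with hw
  set h : EllOne G := comap (fun g => pure g * p) (hinj p) (map j hj f) with hh
  have hh1 : h 1 = f p₀ := by
    rw [hh, comap_apply, one_mul', hp, map_apply]
  set u : EllOne T := map k hkinj (conjInv h) with hu
  set a := map j hj (u * f) with ha
  have ha' : a = map j hj u * map j hj f := map_mul_of_hom hj hjmul u f
  have hsupp_u : ∀ x, map j hj u x ≠ 0 → ∃ g, pure g * q = x := by
    intro x hx
    obtain ⟨t, rfl, ht⟩ := exists_of_map_apply_ne_zero hj u hx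
    obtain ⟨g, rfl, -⟩ := exists_of_map_apply_ne_zero hkinj _ ht
    exact ⟨g, (hk g).symm⟩
  -- the base case of the comparison with `ℓ¹(G)`
  have hbase : comap (fun g => pure g * w) (hinj w) a = conjInv h * h := by
    rw [ha', comap_mul (hinj q) (hinj p) (hinj w) (fun x y => pure_mul_mul_pure_mul x y q p) _ _ ?_]
    · congr 1
      refine ext' fun g => ?_
      rw [comap_apply, ← hk, map_apply, hu, map_apply]
    · intro x y t hx hy hxy
      obtain ⟨g, rfl⟩ := hsupp_u x hx
      obtain ⟨r, rfl, hr⟩ := exists_of_map_apply_ne_zero hj f hy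
      obtain ⟨g', hg'⟩ := hsep r hr (pure g) (pure t) (by rw [← mul_assoc]; exact hxy)
      exact ⟨⟨g, rfl⟩, ⟨g', hg'.symm⟩⟩
  have hstep : ∀ (b : EllOne (Ultrafilter G)) (v : Ultrafilter G),
      comap (fun g => pure g * (v * w)) (hinj (v * w)) (b * a) =
        comap (fun g => pure g * v) (hinj v) b * comap (fun g => pure g * w) (hinj w) a := by
    intro b v
    refine comap_mul (hinj v) (hinj w) (hinj (v * w))
      (fun x y => pure_mul_mul_pure_mul x y v w) b a ?_
    · intro x y t _ hy hxy
      rw [ha'] at hy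
      obtain ⟨y₁, y₂, hy₁, hy₂, rfl⟩ := exists_of_mul_apply_ne_zero hy
      obtain ⟨g, rfl⟩ := hsupp_u y₁ hy₁
      obtain ⟨r, rfl, hr⟩ := exists_of_map_apply_ne_zero hj f hy₂
      obtain ⟨g', hg'⟩ := hsep r hr (x * pure g) (pure t * v) (by
        simp only [mul_assoc] at hxy ⊢
        exact hxy)
      have hy' : pure g * q * j r = pure (g * g') * w := by
        rw [hg', pure_mul_mul_pure_mul]
      rw [hy'] at hxy
      have hx := hcancel (x * pure (g * g')) (pure t * v) (by
        simp only [mul_assoc] at hxy ⊢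
        exact hxy)
      rw [← pure_mul_comm, pure_mul_eq_iff, ← mul_assoc, Ultrafilter.pure_mul_pure] at hx
      exact ⟨⟨_, hx.symm⟩, ⟨g * g', hy'.symm⟩⟩
  have hpow : ∀ n, comap (fun g => pure g * succPow w n) (hinj _) (succPow a n) =
      succPow (conjInv h * h) n := by
    intro n
    induction n with
    | zero => exact hbase
    | succ n ih =>
      change _ = succPow (conjInv h * h) n * (conjInv h * h)
      rw [← ih, ← hbase]
      exact hstep _ _
  have hmap : ∀ n, map j hj (succPow (u * f) n) = succPow a n := by
    intro n
    induction n with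
    | zero => rfl
    | succ n ih => rw [succPow, map_mul_of_hom hj hjmul, ih, succPow]
  obtain ⟨n, hn⟩ := exists_norm_succPow_lt
    (jacobsonRadical_mul_left u hf) (show 0 < ‖h 1‖ ^ 2 by rw [hh1]; positivity)
  refine absurd (pow_le_norm_succPow_one h 1 n) (not_le.2 (lt_of_le_of_lt ?_ hn))
  rw [← hpow, comap_apply, ← hmap]
  exact norm_map_apply_le _ _ _

/-- An element of the radical of `ℓ¹(S*)` is supported on the minimum ideal. -/
theorem supp_subset_minimumIdeal {S : Type u} [CommSemigroup S] [IsCancelMul S] [Countable S]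
    {f : EllOne (StoneCechRemainder S)}
    (hf : f ∈ jacobsonRadical (EllOne (StoneCechRemainder S))) :
    supp f ⊆ minimumIdeal (StoneCechRemainder S) := by
  intro p₀ hp₀
  by_contra hK
  have : Nonempty S := by
    by_contra hS
    rw [not_nonempty_iff] at hS
    obtain ⟨s, -⟩ := Ultrafilter.eq_pure_of_finite p₀.1
    exact hS.elim s
  have : Nonempty (StoneCechRemainder S) := ⟨p₀⟩
  obtain ⟨G, _, _, ι, hι, hfrac⟩ := exists_embedding_commGroup S
  let j := StoneCechRemainder.toUltrafilter ι
  have hj : j.Injective := StoneCechRemainder.toUltrafilter_injective hι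
  have hjmul : ∀ x y, j (x * y) = j x * j y := StoneCechRemainder.toUltrafilter_mul ι
  obtain ⟨d, hd⟩ := StoneCechRemainder.divisible_nonempty hι hfrac p₀
  obtain ⟨e, -, hmin⟩ := exists_minimal_idempotent
    (StoneCechRemainder.continuous_mul_left (S := S))
  have heK := mem_minimumIdeal_of_minimal hmin
  -- `y * x * r` lies in the minimum ideal of `S*` for all `y ∈ βG` and `r ∈ S*`
  set x := d * j e * d with hxdef
  have hxd : x ∈ StoneCechRemainder.divisible ι :=
    StoneCechRemainder.mul_mem_divisible hι _ hd
  have hx : ∀ y, ∀ r ∈ j '' supp f, y * (x * r) ≠ j p₀ := by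
    rintro y _ ⟨r, -, rfl⟩ hy
    obtain ⟨b, hb⟩ := StoneCechRemainder.mem_range_of_mem_divisible
      (StoneCechRemainder.mul_mem_divisible hι y hd)
    obtain ⟨c, hc⟩ := StoneCechRemainder.mem_range_of_mem_divisible hd
    have h1 : j (b * e * (c * r)) = j p₀ := by
      have hb' : j b = y * d := hb
      have hc' : j c = d := hc
      rw [← hy, hjmul, hjmul, hjmul, hxdef, hb', hc']
      simp only [mul_assoc]
    rw [← hj h1] at hK
    exact hK (mul_mem_minimumIdeal_right (mul_mem_minimumIdeal_left b heK) _)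
  have hxd' := (StoneCechRemainder.mem_divisible_iff hι).1 hxd
  obtain ⟨q, hqC, hcancel, hsep⟩ := exists_mul_right_cancellable
    (f.summable.countable_support.image j) ⟨p₀, hp₀, rfl⟩ hx
    (C := fun i : G × G => {n | i.1 * n ∈ Set.range ι} ∩ {i.2}ᶜ) (fun i => by
      refine inter_mem (hxd'.1 i.1) (compl_mem_iff_notMem.2 fun h => hxd'.2 i.2 ?_)
      obtain ⟨g, hg, hxg⟩ := eq_pure_of_finite_mem (Set.finite_singleton _) h
      rw [hxg, Set.mem_singleton_iff.1 hg])
  have hqd : q ∈ StoneCechRemainder.divisible ι :=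
    (StoneCechRemainder.mem_divisible_iff hι).2
      ⟨fun g => mem_of_superset (hqC (g, 1)) Set.inter_subset_left, fun g hg => by
        have h1 := hqC (1, g)
        rw [hg] at h1
        exact (Ultrafilter.mem_pure.1 h1).2 rfl⟩
  exact hp₀ (apply_eq_zero_of_mem_jacobsonRadical hj hjmul hf hqd hcancel
    fun r hr => hsep (j r) ⟨r, hr, rfl⟩)

end EllOne

theorem mainTheorem1 (S : Type u) [CommSemigroup S] [IsCancelMul S] [Countable S]
    (f : EllOne (StoneCechRemainder S)) :
    (f ∈ jacobsonRadical (EllOne (StoneCechRemainder S)) ↔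
      EllOne.supp f ⊆ minimumIdeal (StoneCechRemainder S) ∧
      ∀ p ∈ minimumIdeal (StoneCechRemainder S), ∀ q ∈ minimumIdeal (StoneCechRemainder S),
        EllOne.delta p * f * EllOne.delta q = 0) ∧
    (f ∈ jacobsonRadical (EllOne (StoneCechRemainder S)) →
      ∀ g : EllOne (StoneCechRemainder S), IsNilpotentOfIndexAtMost (g * f) 3) := by
  have hnec : f ∈ jacobsonRadical (EllOne (StoneCechRemainder S)) →
      EllOne.supp f ⊆ minimumIdeal (StoneCechRemainder S) ∧
      ∀ p ∈ minimumIdeal (StoneCechRemainder S), ∀ q ∈ minimumIdeal (StoneCechRemainder S),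
        EllOne.delta p * f * EllOne.delta q = 0 := fun hf =>
    ⟨EllOne.supp_subset_minimumIdeal hf, fun p hp q hq => by
      have : Nonempty (StoneCechRemainder S) := ⟨p⟩
      exact EllOne.delta_mul_mul_delta_eq_zero StoneCechRemainder.continuous_mul_left hf hp hq⟩
  have hcube : (EllOne.supp f ⊆ minimumIdeal (StoneCechRemainder S) ∧
      ∀ p ∈ minimumIdeal (StoneCechRemainder S), ∀ q ∈ minimumIdeal (StoneCechRemainder S),
        EllOne.delta p * f * EllOne.delta q = 0) →
      ∀ y : Unitization ℂ (EllOne (StoneCechRemainder S)),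
        (y * (f : Unitization ℂ (EllOne (StoneCechRemainder S)))) ^ 3 = 0 := fun h =>
    EllOne.pow_three_eq_zero (fun s _ => mul_mem_minimumIdeal_left s)
      (fun s _ ht => mul_mem_minimumIdeal_right ht s) h.1 h.2
  refine ⟨⟨hnec, fun h => EllOne.mem_jacobsonRadical_of_forall_pow_three (hcube h)⟩,
    fun hf g => ⟨3, by norm_num, le_rfl, ?_⟩⟩
  rw [Unitization.inr_mul]
  exact hcube (hnec hf) g
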